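/- There is an absolute constant $C>0$ such that the following holds. Let $n,m,k\ge 0$ be integers with $m\ge 1$ and $m+k\le n$, put $\varepsilon'=k/m$, so that $\varepsilon' m=k$, and let $K\ge 1$. Let $A$ be an $n\times n$ random complex matrix such that (i) for all $i,j\in[n]$ the entry $A_{ij}$ is independent of the family of all the other entries except possibly $A_{ji}$; (ii) the imaginary parts of the entries are fixed (non-random); (iii) the real part of every entry has a density bounded by $K$. Let $\lambda\in\mathbb C$ and let $B$ be the upper left $(1+\varepsilon')m\times m$ block of $A-\lambda I$, with columns $B_1,\dots,B_m$. For $j\in[m]$ let $B'_j\in\mathbb C^{(1+\varepsilon')m-1}$ be $B_j$ with its $j$-th coordinate removed, and let $H'_j\subseteq\mathbb C^{(1+\varepsilon')m-1}$ be the complex span of the columns $B_l$, $l\in[m]\setminus\{j\}$, each with its $j$-th coordinate removed. Then for every $j\in[m]$ and $\tau>0$ $$\mathbb P\bigl(\operatorname{dist}(B'_j,H'_j)<\tau\sqrt{\varepsilon' m}\bigr)\le (CK\tau)^{\varepsilon' m},$$ where $\operatorname{dist}$ is the Euclidean distance. -/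

import Mathlib

open MeasureTheory ProbabilityTheory

/-- A random `n × n` complex matrix whose entry `A i j` is, for all `i, j`, independent of the (joint)
family of all the other entries except possibly `A j i`, and whose imaginary part is deterministic
(almost surely equal to a fixed real matrix). -/
structure EntryDependence {Ω : Type*} [MeasurableSpace Ω] (P : Measure Ω) {n : ℕ}
    (A : Ω → Matrix (Fin n) (Fin n) ℂ) : Prop where
  measurable_entry : ∀ i j, Measurable fun ω => A ω i j
  indep : ∀ i j, IndepFun (fun ω => A ω i j)
    (fun ω (p : {p : Fin n × Fin n // p ≠ (i, j) ∧ p ≠ (j, i)}) => A ω p.1.1 p.1.2) P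
  im_fixed : ∀ i j, ∃ y : ℝ, ∀ᵐ ω ∂P, (A ω i j).im = y

/-- The real part of every entry is absolutely continuous with respect to the Lebesgue measure, with
a density that is at most `K` almost everywhere. -/
def BoundedDensities {Ω : Type*} [MeasurableSpace Ω] (P : Measure Ω) {n : ℕ}
    (A : Ω → Matrix (Fin n) (Fin n) ℂ) (K : ℝ) : Prop :=
  ∀ i j, HasPDF (fun ω => (A ω i j).re) P volume ∧
    ∀ᵐ x : ℝ, pdf (fun ω => (A ω i j).re) P volume x ≤ ENNReal.ofReal K

/-- The matrix `B`: the upper left `(m + k) × m` block of `M - z I`, where `m + k ≤ n`. -/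
def shiftedBlock {n m k : ℕ} (h : m + k ≤ n) (M : Matrix (Fin n) (Fin n) ℂ) (z : ℂ) :
    Matrix (Fin (m + k)) (Fin m) ℂ :=
  (M - z • (1 : Matrix (Fin n) (Fin n) ℂ)).submatrix (Fin.castLE h)
    (Fin.castLE ((Nat.le_add_right m k).trans h))

/-- The `l`-th column of `B` with its `j`-th coordinate removed, a vector of `ℂ ^ (m + k - 1)` with
the Euclidean norm. -/
noncomputable def reducedColumn {m k : ℕ} (B : Matrix (Fin (m + k)) (Fin m) ℂ) (j l : Fin m) :
    EuclideanSpace ℂ {i : Fin (m + k) // i ≠ Fin.castAdd k j} :=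
  WithLp.toLp 2 fun i => B i.1 l

/-- The subspace `H'_j`: the complex span of the columns of `B` other than the `j`-th one, each with
its `j`-th coordinate removed. -/
noncomputable def reducedSpan {m k : ℕ} (B : Matrix (Fin (m + k)) (Fin m) ℂ) (j : Fin m) :
    Submodule ℂ (EuclideanSpace ℂ {i : Fin (m + k) // i ≠ Fin.castAdd k j}) :=
  Submodule.span ℂ {v | ∃ l : Fin m, l ≠ j ∧ v = reducedColumn B j l}

/-- The distance from `B'_j` to `H'_j`. -/
noncomputable def reducedDist {m k : ℕ} (B : Matrix (Fin (m + k)) (Fin m) ℂ) (j : Fin m) : ℝ :=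
  Metric.infDist (reducedColumn B j j)
    (reducedSpan B j : Set (EuclideanSpace ℂ {i : Fin (m + k) // i ≠ Fin.castAdd k j}))

/-!
Fix `j`. The off-diagonal entries of the `j`-th column are independent of each other and of the
other columns with their `j`-th row removed, because none of these is the transposed entry `A j i`.
Conditionally on the other columns, the distance is therefore that of a random vector, with
independent real parts of density at most `K` and fixed imaginary parts, to a fixed complex subspace
`H` of codimension at least `k` (`measure_infDist_columnSpan_lt_le`), and equals the length of its
projection `Q` to the orthogonal complement of `H`.

Reduction to real projections. The real symmetric operator `Re Q` has at least `k` eigenvalues that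
are at least `1 / 2`; hence, up to a factor `√2`, the length of the projection dominates that of a
translate of the real vector projected to a real subspace `F` of dimension `k`
(`exists_real_subspace`). By Markov's inequality it suffices to bound the average of
`exp (-|P_F (X - w)|² / 2t²)` by `(C K t) ^ k` (`lintegral_exp_neg_norm_starProjection_le`).

The Gaussian average. A coordinate `i` with `|P_F e_i|² > 1 / 2` can be integrated out, which lowers
the dimension of `F` by one and costs a factor `O(K t)`. When there is none left, let `V` be the
`k × N` matrix whose rows are an orthonormal basis of `F`, with columns `v_i`, and put
`c_i = |v_i|² ≤ 1 / 2`. By Fourier inversion the average is at most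
`t ^ k ∫ ∏ |φ_i ⟨v_i, η⟩| dη`, where `φ_i` is the characteristic function of the `i`-th coordinate.

The integral of the product is bounded by a Brascamp–Lieb type inequality
(`lintegral_prod_le_of_orthonormal_rows`). By the Cauchy–Binet formula, the numbers
`det (V_p)² / k!` are a probability distribution on tuples `p` of `k` columns, under which the column
`i` has expected multiplicity `c_i`. So the product is a weighted geometric mean of the products
`∏ |φ_{p a}| ^ (1 / c_{p a})`, to which Hölder's inequality applies; each of these has integral
`∏ ∫ |φ_{p a}| ^ (1 / c_{p a})` divided by `|det V_p|`. A one-dimensional estimate,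
`∫ |φ| ^ r = O(K / √r)` for `r ≥ 2` (`lintegral_norm_charFun_rpow_le`), bounds the factors by
`O(K √c)`, and by the inequality between the arithmetic and the geometric mean all factors `√c` and
`1 / |det V_p|` together contribute at most `√(k ^ k / k!) ≤ e ^ (k / 2)`.

The one-dimensional estimate rests on `∫ |φ|² ≤ 2 π K` and on the doubling property
`T u + T u ⊆ T (4 u)` of the sets `T u = {1 - |φ|² ≤ u}`, which with `|A + A| ≥ 2 |A|` gives
`|T u| = O(K √u)`.
-/

open scoped ENNReal NNReal Pointwise

/-! ### Characteristic functions of bounded densities on the line -/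


theorem norm_charFun_sq_eq_integral_cos (μ : Measure ℝ) [IsProbabilityMeasure μ] (s : ℝ) :
    ‖charFun μ s‖ ^ 2 = ∫ p : ℝ × ℝ, Real.cos (s * (p.1 - p.2)) ∂(μ.prod μ) := by
  have hc : Integrable (fun x => Real.cos (s * x)) μ :=
    Integrable.of_bound (C := 1) (by fun_prop) (ae_of_all _ fun x => by
      simpa using Real.abs_cos_le_one _)
  have hs : Integrable (fun x => Real.sin (s * x)) μ :=
    Integrable.of_bound (C := 1) (by fun_prop) (ae_of_all _ fun x => by
      simpa using Real.abs_sin_le_one _)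
  have hchar : charFun μ s = (∫ x, Real.cos (s * x) ∂μ : ℝ) +
      (∫ x, Real.sin (s * x) ∂μ : ℝ) * Complex.I := by
    rw [charFun_apply_real, ← integral_complex_ofReal, ← integral_complex_ofReal,
      ← integral_mul_const, ← integral_add hc.ofReal (hs.ofReal.mul_const _)]
    refine integral_congr_ae (ae_of_all _ fun x => ?_)
    simp only [← Complex.ofReal_mul, Complex.exp_mul_I]
    push_cast
    rfl
  rw [hchar, ← Complex.normSq_eq_norm_sq, Complex.normSq_add_mul_I]
  have : ∀ p : ℝ × ℝ, Real.cos (s * (p.1 - p.2)) =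
      Real.cos (s * p.1) * Real.cos (s * p.2) + Real.sin (s * p.1) * Real.sin (s * p.2) := by
    intro p
    rw [mul_sub, Real.cos_sub]
  simp_rw [this]
  rw [integral_add (hc.mul_prod hc) (hs.mul_prod hs),
    integral_prod_mul (fun x => Real.cos (s * x)) (fun x => Real.cos (s * x)),
    integral_prod_mul (fun x => Real.sin (s * x)) (fun x => Real.sin (s * x))]
  ring

theorem norm_charFun_sq_le_one (μ : Measure ℝ) [IsProbabilityMeasure μ] (s : ℝ) :
    ‖charFun μ s‖ ^ 2 ≤ 1 :=
  pow_le_one₀ (norm_nonneg _) (norm_charFun_le_one s)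

theorem integrable_cos_mul_sub (μ : Measure ℝ) [IsProbabilityMeasure μ] (s : ℝ) :
    Integrable (fun p : ℝ × ℝ => Real.cos (s * (p.1 - p.2))) (μ.prod μ) :=
  Integrable.of_bound (C := 1) (by fun_prop) (ae_of_all _ fun x => by
    simpa using Real.abs_cos_le_one _)

theorem one_sub_cos_add_le (a b : ℝ) :
    1 - Real.cos (a + b) ≤ 2 * (1 - Real.cos a) + 2 * (1 - Real.cos b) := by
  have h (x : ℝ) : 1 - Real.cos x = 2 * Real.sin (x / 2) ^ 2 := by
    have := Real.cos_sq' (x / 2)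
    have h2 := Real.cos_two_mul (x / 2)
    rw [mul_div_cancel₀ _ two_ne_zero] at h2
    linarith
  rw [h, h, h, add_div, Real.sin_add]
  have ha := Real.sin_sq_add_cos_sq (a / 2)
  have hb := Real.sin_sq_add_cos_sq (b / 2)
  nlinarith [sq_nonneg (Real.sin (a / 2) * Real.cos (b / 2) - Real.cos (a / 2) * Real.sin (b / 2)),
    mul_nonneg (sq_nonneg (Real.sin (a / 2))) (sq_nonneg (Real.sin (b / 2)))]

/-- The quantity `1 - |φ(s)|²` is subadditive in `s` up to a factor two, as it is the mean of
`1 - cos (s Y)` for the symmetrized variable `Y`. -/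
theorem one_sub_norm_charFun_sq_add_le (μ : Measure ℝ) [IsProbabilityMeasure μ] (s t : ℝ) :
    1 - ‖charFun μ (s + t)‖ ^ 2 ≤
      2 * (1 - ‖charFun μ s‖ ^ 2) + 2 * (1 - ‖charFun μ t‖ ^ 2) := by
  have hi (s : ℝ) : 1 - ‖charFun μ s‖ ^ 2 =
      ∫ p : ℝ × ℝ, (1 - Real.cos (s * (p.1 - p.2))) ∂(μ.prod μ) := by
    rw [integral_sub (integrable_const _) (integrable_cos_mul_sub μ s),
      norm_charFun_sq_eq_integral_cos]
    simp
  have hint (s : ℝ) : Integrable (fun p : ℝ × ℝ => 1 - Real.cos (s * (p.1 - p.2))) (μ.prod μ) :=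
    (integrable_const _).sub (integrable_cos_mul_sub μ s)
  rw [hi, hi, hi, ← integral_const_mul, ← integral_const_mul,
    ← integral_add ((hint s).const_mul 2) ((hint t).const_mul 2)]
  refine integral_mono (hint _) (((hint s).const_mul 2).add ((hint t).const_mul 2)) fun p => ?_
  simp only [add_mul]
  exact one_sub_cos_add_le _ _

theorem integral_cos_mul_exp_neg_mul_sq {ε : ℝ} (hε : 0 < ε) (d : ℝ) :
    ∫ s : ℝ, Real.cos (s * d) * Real.exp (-ε * s ^ 2) =
      Real.sqrt (Real.pi / ε) * Real.exp (-(d ^ 2 / (4 * ε))) := by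
  have h := fourierIntegral_gaussian (b := (ε : ℂ)) (by simpa using hε) (d : ℂ)
  have hint : Integrable fun x : ℝ => Complex.exp (Complex.I * d * x) *
      Complex.exp (-(ε : ℂ) * (x : ℂ) ^ 2) := by
    refine (integrable_exp_neg_mul_sq hε).mono' (by fun_prop) (ae_of_all _ fun x => ?_)
    rw [norm_mul, Complex.norm_exp, Complex.norm_exp]
    simp [← Complex.ofReal_pow]
  have hre := congrArg Complex.re h
  rw [← RCLike.re_eq_complex_re, ← integral_re hint] at hre
  have e1 : ∀ x : ℝ, RCLike.re (Complex.exp (Complex.I * d * x) *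
      Complex.exp (-(ε : ℂ) * (x : ℂ) ^ 2)) = Real.cos (x * d) * Real.exp (-ε * x ^ 2) := by
    intro x
    have : Complex.I * d * x = ((x * d : ℝ) : ℂ) * Complex.I := by push_cast; ring
    rw [this, Complex.exp_mul_I, ← Complex.ofReal_cos, ← Complex.ofReal_sin]
    have : Complex.exp (-(ε : ℂ) * (x : ℂ) ^ 2) = ((Real.exp (-ε * x ^ 2) : ℝ) : ℂ) := by
      push_cast; rfl
    rw [this, RCLike.re_eq_complex_re, Complex.re_mul_ofReal, Complex.add_re, Complex.ofReal_re,
      Complex.re_ofReal_mul, Complex.I_re, mul_zero, add_zero]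
  simp_rw [e1] at hre
  rw [hre]
  have e2 : ((Real.pi : ℂ) / ε) ^ (1 / 2 : ℂ) = ((Real.sqrt (Real.pi / ε) : ℝ) : ℂ) := by
    rw [Real.sqrt_eq_rpow, Complex.ofReal_cpow (by positivity)]
    push_cast; rfl
  have e3 : Complex.exp (-(d : ℂ) ^ 2 / (4 * ε)) =
      ((Real.exp (-(d ^ 2 / (4 * ε))) : ℝ) : ℂ) := by
    push_cast; rw [neg_div]
  rw [e2, e3, RCLike.re_eq_complex_re, ← Complex.ofReal_mul, Complex.ofReal_re]

theorem lintegral_exp_neg_mul_sub_sq {b : ℝ} (hb : 0 < b) (d : ℝ) :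
    ∫⁻ x : ℝ, ENNReal.ofReal (Real.exp (-b * (x - d) ^ 2)) =
      ENNReal.ofReal (Real.sqrt (Real.pi / b)) := by
  rw [lintegral_sub_right_eq_self (fun x : ℝ => ENNReal.ofReal (Real.exp (-b * x ^ 2))) d,
    ← ofReal_integral_eq_lintegral_ofReal (integrable_exp_neg_mul_sq hb)
      (ae_of_all _ fun x => (Real.exp_pos _).le), integral_gaussian]

/-- A law with density at most `K` charges a Gaussian weight by at most `K` times its integral. -/
theorem lintegral_exp_neg_mul_sub_sq_le {μ : Measure ℝ} {K : ℝ≥0}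
    (hμ : μ ≤ (K : ℝ≥0∞) • volume) {b : ℝ} (hb : 0 < b) (d : ℝ) :
    ∫⁻ x : ℝ, ENNReal.ofReal (Real.exp (-b * (x - d) ^ 2)) ∂μ ≤
      K * ENNReal.ofReal (Real.sqrt (Real.pi / b)) := by
  refine (lintegral_mono' hμ le_rfl).trans ?_
  rw [lintegral_smul_measure, lintegral_exp_neg_mul_sub_sq hb, smul_eq_mul]

theorem lintegral_norm_charFun_sq_mul_exp_le {μ : Measure ℝ} [IsProbabilityMeasure μ] {K : ℝ≥0}
    (hμ : μ ≤ (K : ℝ≥0∞) • volume) {ε : ℝ} (hε : 0 < ε) :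
    ∫⁻ s : ℝ, ENNReal.ofReal (‖charFun μ s‖ ^ 2 * Real.exp (-ε * s ^ 2)) ≤
      ENNReal.ofReal (2 * Real.pi) * K := by
  have hmeas : Measurable (charFun μ) := measurable_charFun
  have hint : Integrable fun s : ℝ => ‖charFun μ s‖ ^ 2 * Real.exp (-ε * s ^ 2) := by
    refine (integrable_exp_neg_mul_sq hε).mono' (by fun_prop) (ae_of_all _ fun s => ?_)
    rw [Real.norm_of_nonneg (by positivity)]
    exact mul_le_of_le_one_left (Real.exp_pos _).le (norm_charFun_sq_le_one μ s)
  have hint2 : Integrable (Function.uncurry fun (s : ℝ) (p : ℝ × ℝ) =>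
      Real.cos (s * (p.1 - p.2)) * Real.exp (-ε * s ^ 2)) (volume.prod (μ.prod μ)) := by
    refine ((integrable_exp_neg_mul_sq hε).comp_fst (μ.prod μ)).mono'
      (by unfold Function.uncurry; fun_prop) (ae_of_all _ fun s => ?_)
    simp only [Function.uncurry]
    rw [norm_mul, Real.norm_of_nonneg (Real.exp_pos _).le]
    exact mul_le_of_le_one_left (Real.exp_pos _).le (Real.abs_cos_le_one _)
  rw [← ofReal_integral_eq_lintegral_ofReal hint (ae_of_all _ fun s => by positivity)]
  simp_rw [norm_charFun_sq_eq_integral_cos, ← integral_mul_const]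
  rw [integral_integral_swap hint2]
  simp_rw [integral_cos_mul_exp_neg_mul_sq hε, integral_const_mul]
  rw [ENNReal.ofReal_mul (Real.sqrt_nonneg _), ofReal_integral_eq_lintegral_ofReal
    (Integrable.of_bound (C := 1) (by fun_prop) (ae_of_all _ fun p => by
      rw [Real.norm_of_nonneg (Real.exp_pos _).le, Real.exp_le_one_iff]
      have : 0 ≤ (p.1 - p.2) ^ 2 / (4 * ε) := by positivity
      linarith))
    (ae_of_all _ fun p => (Real.exp_pos _).le), lintegral_prod_symm _ (by fun_prop)]
  have hb : 0 < 1 / (4 * ε) := by positivity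
  calc ENNReal.ofReal (Real.sqrt (Real.pi / ε)) *
        ∫⁻ y, ∫⁻ x, ENNReal.ofReal (Real.exp (-((x - y) ^ 2 / (4 * ε)))) ∂μ ∂μ
      ≤ ENNReal.ofReal (Real.sqrt (Real.pi / ε)) *
        ∫⁻ _y, K * ENNReal.ofReal (Real.sqrt (Real.pi / (1 / (4 * ε)))) ∂μ := by
        gcongr with y
        refine le_trans (le_of_eq ?_) (lintegral_exp_neg_mul_sub_sq_le hμ hb y)
        refine lintegral_congr fun x => ?_
        congr 2
        ring
    _ = ENNReal.ofReal (2 * Real.pi) * K := by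
        rw [lintegral_const, measure_univ, mul_one, mul_left_comm,
          ← ENNReal.ofReal_mul (Real.sqrt_nonneg _), ← Real.sqrt_mul (by positivity), mul_comm]
        congr 2
        rw [show Real.pi / ε * (Real.pi / (1 / (4 * ε))) = (2 * Real.pi) ^ 2 by field_simp; ring]
        exact Real.sqrt_sq (by positivity)

/-- The easy half of Plancherel's theorem: a law with density at most `K` has a characteristic
function whose square has integral at most `2 π K`. -/
theorem lintegral_norm_charFun_sq_le {μ : Measure ℝ} [IsProbabilityMeasure μ] {K : ℝ≥0}
    (hμ : μ ≤ (K : ℝ≥0∞) • volume) :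
    ∫⁻ s : ℝ, ENNReal.ofReal (‖charFun μ s‖ ^ 2) ≤ ENNReal.ofReal (2 * Real.pi) * K := by
  have hmeas : Measurable (charFun μ) := measurable_charFun
  have hlim (s : ℝ) : Filter.Tendsto (fun n : ℕ =>
      ENNReal.ofReal (‖charFun μ s‖ ^ 2 * Real.exp (-(1 / ((n : ℝ) + 1)) * s ^ 2)))
      Filter.atTop (nhds (ENNReal.ofReal (‖charFun μ s‖ ^ 2))) := by
    refine ENNReal.tendsto_ofReal ?_
    have h0 : Filter.Tendsto (fun n : ℕ => -(1 / ((n : ℝ) + 1)) * s ^ 2) Filter.atTop (nhds 0) := by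
      simpa using (tendsto_one_div_add_atTop_nhds_zero_nat (𝕜 := ℝ)).neg.mul_const (s ^ 2)
    simpa using ((Real.continuous_exp.tendsto 0).comp h0).const_mul (‖charFun μ s‖ ^ 2)
  calc ∫⁻ s : ℝ, ENNReal.ofReal (‖charFun μ s‖ ^ 2)
      = ∫⁻ s : ℝ, Filter.liminf (fun n : ℕ => ENNReal.ofReal
          (‖charFun μ s‖ ^ 2 * Real.exp (-(1 / ((n : ℝ) + 1)) * s ^ 2))) Filter.atTop :=
        lintegral_congr fun s => (hlim s).liminf_eq.symm
    _ ≤ Filter.liminf (fun n : ℕ => ∫⁻ s : ℝ, ENNReal.ofReal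
          (‖charFun μ s‖ ^ 2 * Real.exp (-(1 / ((n : ℝ) + 1)) * s ^ 2))) Filter.atTop :=
        lintegral_liminf_le fun n => by fun_prop
    _ ≤ ENNReal.ofReal (2 * Real.pi) * K := by
        refine Filter.liminf_le_of_le (by isBoundedDefault) fun b hb => ?_
        obtain ⟨n, hn⟩ := hb.exists
        exact hn.trans (lintegral_norm_charFun_sq_mul_exp_le hμ (by positivity))

/-- The one-dimensional Brunn–Minkowski inequality for `A + A`: two translates of `A`, by its least
and by its greatest element, overlap in a single point. -/
theorem two_mul_volume_le_of_add_subset {A B : Set ℝ} (hA : IsCompact A) (hAB : A + A ⊆ B) :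
    2 * volume A ≤ volume B := by
  rcases A.eq_empty_or_nonempty with rfl | hne
  · simp
  obtain ⟨a, haA, ha⟩ := hA.exists_isLeast hne
  obtain ⟨b, hbA, hb⟩ := hA.exists_isGreatest hne
  have hdisj : AEDisjoint volume ((fun x => a + x) '' A) ((fun x => b + x) '' A) := by
    refine measure_mono_null (t := {a + b}) ?_ (by simp)
    rintro _ ⟨⟨x, hx, rfl⟩, ⟨y, hy, hxy⟩⟩
    have h1 := ha hx; have h2 := hb hx; have h3 := ha hy; have h4 := hb hy
    simp only at hxy
    simp only [Set.mem_singleton_iff]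
    linarith
  have hmeas : MeasurableSet ((fun x => b + x) '' A) :=
    (hA.image (by fun_prop)).measurableSet
  calc 2 * volume A = volume ((fun x => a + x) '' A) + volume ((fun x => b + x) '' A) := by
        simp [two_mul]
    _ = volume (((fun x => a + x) '' A) ∪ ((fun x => b + x) '' A)) :=
        (measure_union₀ hmeas.nullMeasurableSet hdisj).symm
    _ ≤ volume B := by
        refine measure_mono (Set.union_subset ?_ ?_)
        · rintro _ ⟨x, hx, rfl⟩; exact hAB (Set.add_mem_add haA hx)
        · rintro _ ⟨x, hx, rfl⟩; exact hAB (Set.add_mem_add hbA hx)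

theorem two_pow_mul_volume_le {μ : Measure ℝ} [IsProbabilityMeasure μ] {K : ℝ≥0}
    (hμ : μ ≤ (K : ℝ≥0∞) • volume) (j : ℕ) {u : ℝ} (hu : 4 ^ j * u ≤ 1 / 2) :
    2 ^ j * volume {s : ℝ | 1 - ‖charFun μ s‖ ^ 2 ≤ u} ≤ ENNReal.ofReal (4 * Real.pi) * K := by
  have hmeas : Measurable (charFun μ) := measurable_charFun
  induction j generalizing u with
  | zero =>
    have h := (mul_meas_ge_le_lintegral (μ := volume)
      (f := fun s => ENNReal.ofReal (‖charFun μ s‖ ^ 2)) (by fun_prop)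
      (ENNReal.ofReal (1 / 2))).trans (lintegral_norm_charFun_sq_le hμ)
    have hsub : {s : ℝ | 1 - ‖charFun μ s‖ ^ 2 ≤ u} ⊆
        {s | ENNReal.ofReal (1 / 2) ≤ ENNReal.ofReal (‖charFun μ s‖ ^ 2)} := by
      intro s hs
      simp only [Set.mem_ofPred_eq] at hs ⊢
      refine ENNReal.ofReal_le_ofReal ?_
      norm_num at hu
      linarith
    have h2 : ENNReal.ofReal (1 / 2) * volume {s : ℝ | 1 - ‖charFun μ s‖ ^ 2 ≤ u} ≤
        ENNReal.ofReal (2 * Real.pi) * K :=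
      (mul_le_mul_right (measure_mono hsub) _).trans h
    calc 2 ^ 0 * volume {s : ℝ | 1 - ‖charFun μ s‖ ^ 2 ≤ u}
        = ENNReal.ofReal 2 * (ENNReal.ofReal (1 / 2) *
            volume {s : ℝ | 1 - ‖charFun μ s‖ ^ 2 ≤ u}) := by
          rw [← mul_assoc, ← ENNReal.ofReal_mul (by norm_num)]
          norm_num
      _ ≤ ENNReal.ofReal 2 * (ENNReal.ofReal (2 * Real.pi) * K) := by gcongr
      _ = ENNReal.ofReal (4 * Real.pi) * K := by
          rw [← mul_assoc, ← ENNReal.ofReal_mul (by norm_num)]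
          congr 2; ring
  | succ j ih =>
    refine le_trans ?_ (ih (u := 4 * u) (by rw [pow_succ] at hu; linarith))
    rw [pow_succ, mul_assoc]
    gcongr
    have hms : MeasurableSet {s : ℝ | 1 - ‖charFun μ s‖ ^ 2 ≤ u} :=
      measurableSet_le (by fun_prop) (by fun_prop)
    rw [hms.measure_eq_iSup_isCompact, ENNReal.mul_iSup]
    refine iSup_le fun A => ?_
    simp only [ENNReal.mul_iSup]
    refine iSup_le fun hAs => iSup_le fun hA => two_mul_volume_le_of_add_subset hA ?_
    rintro _ ⟨s, hs, t, ht, rfl⟩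
    have h1 := hAs hs; have h2 := hAs ht
    have h3 := one_sub_norm_charFun_sq_add_le μ s t
    simp only [Set.mem_ofPred_eq] at h1 h2 ⊢
    linarith

/-- The set where `|φ|²` is within `u` of one carries `O(K √u)` of the integral of `|φ|²`. For
`u ≤ 1 / 2` this holds because replacing `u` by `4 u` at least doubles the measure of the set, as
long as `u` is of order at most one; for larger `u` the whole integral is `O(K)`. -/
theorem lintegral_indicator_norm_charFun_sq_le {μ : Measure ℝ} [IsProbabilityMeasure μ] {K : ℝ≥0}
    (hμ : μ ≤ (K : ℝ≥0∞) • volume) {u : ℝ} (hu : 0 < u) :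
    ∫⁻ s in {s : ℝ | 1 - ‖charFun μ s‖ ^ 2 ≤ u}, ENNReal.ofReal (‖charFun μ s‖ ^ 2) ≤
      ENNReal.ofReal (4 * Real.pi * Real.sqrt 8 * Real.sqrt u) * K := by
  have h8 : Real.sqrt 8 * Real.sqrt u = Real.sqrt (8 * u) := (Real.sqrt_mul (by norm_num) _).symm
  rcases le_or_gt u (1 / 2) with h | h
  · obtain ⟨j, hj1, hj2⟩ := exists_nat_pow_near (x := 1 / (2 * u)) (y := (4 : ℝ))
      (by rw [le_div_iff₀ (by positivity)]; linarith) (by norm_num)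
    have hj : (4 : ℝ) ^ j * u ≤ 1 / 2 := by
      rw [le_div_iff₀ (by positivity)] at hj1; linarith
    have hv := two_pow_mul_volume_le hμ j hj
    have h2 : 1 ≤ Real.sqrt (8 * u) * 2 ^ j := by
      rw [div_lt_iff₀ (by positivity), pow_succ] at hj2
      have : (1 : ℝ) = Real.sqrt 1 := by simp
      rw [this, show (2 : ℝ) ^ j = Real.sqrt (4 ^ j) by
        rw [show (4 : ℝ) ^ j = (2 ^ j) ^ 2 by rw [← pow_mul, mul_comm, pow_mul]; norm_num]
        exact (Real.sqrt_sq (by positivity)).symm, ← Real.sqrt_mul (by positivity)]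
      exact Real.sqrt_le_sqrt (by nlinarith)
    calc ∫⁻ s in {s : ℝ | 1 - ‖charFun μ s‖ ^ 2 ≤ u}, ENNReal.ofReal (‖charFun μ s‖ ^ 2)
        ≤ ∫⁻ s in {s : ℝ | 1 - ‖charFun μ s‖ ^ 2 ≤ u}, 1 := by
          refine lintegral_mono fun s => ?_
          rw [← ENNReal.ofReal_one]
          exact ENNReal.ofReal_le_ofReal (norm_charFun_sq_le_one μ s)
      _ = volume {s : ℝ | 1 - ‖charFun μ s‖ ^ 2 ≤ u} := by simp
      _ ≤ ENNReal.ofReal (Real.sqrt (8 * u) * 2 ^ j) *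
            volume {s : ℝ | 1 - ‖charFun μ s‖ ^ 2 ≤ u} := by
          refine le_mul_of_one_le_left' ?_
          rw [← ENNReal.ofReal_one]
          exact ENNReal.ofReal_le_ofReal h2
      _ = ENNReal.ofReal (Real.sqrt (8 * u)) * (2 ^ j *
            volume {s : ℝ | 1 - ‖charFun μ s‖ ^ 2 ≤ u}) := by
          rw [ENNReal.ofReal_mul (Real.sqrt_nonneg _), ENNReal.ofReal_pow (by norm_num), mul_assoc]
          norm_num
      _ ≤ ENNReal.ofReal (Real.sqrt (8 * u)) * (ENNReal.ofReal (4 * Real.pi) * K) := by gcongr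
      _ = _ := by
          rw [← mul_assoc, ← ENNReal.ofReal_mul (Real.sqrt_nonneg _), mul_assoc (4 * Real.pi), h8,
            mul_comm (4 * Real.pi)]
  · refine (setLIntegral_le_lintegral _ _).trans ((lintegral_norm_charFun_sq_le hμ).trans ?_)
    refine mul_le_mul_left (ENNReal.ofReal_le_ofReal ?_) _
    rw [mul_assoc (4 * Real.pi), h8]
    have : 1 ≤ Real.sqrt (8 * u) := by
      rw [Real.one_le_sqrt]; linarith
    nlinarith [Real.pi_pos]

/-- The constant in the bound on the `L^p` norms of characteristic functions. -/
noncomputable def charFunConst : ℝ :=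
  ∑' n : ℕ, Real.exp 1 * Real.exp (-n) * (4 * Real.pi * Real.sqrt 8 * Real.sqrt (n + 1))

theorem summable_charFunConst : Summable fun n : ℕ =>
    Real.exp 1 * Real.exp (-n) * (4 * Real.pi * Real.sqrt 8 * Real.sqrt (n + 1)) := by
  have h2 : (2 : ℝ) * Real.exp (-1) < 1 := by
    have := Real.exp_one_gt_d9
    rw [Real.exp_neg, ← div_eq_mul_inv, div_lt_one (Real.exp_pos _)]
    linarith
  refine Summable.of_nonneg_of_le (fun n => by positivity) (fun n => ?_)
    ((summable_geometric_of_lt_one (by positivity) h2).mul_left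
      (Real.exp 1 * (4 * Real.pi * Real.sqrt 8)))
  have hs : Real.sqrt (n + 1) ≤ 2 ^ n := by
    have h1 : ((n : ℝ) + 1) ≤ 2 ^ n := by exact_mod_cast n.lt_two_pow_self
    refine (Real.sqrt_le_sqrt h1).trans ?_
    rw [Real.sqrt_le_left (by positivity)]
    exact le_self_pow₀ (one_le_pow₀ (by norm_num)) two_ne_zero
  have he : Real.exp (-n) = Real.exp (-1) ^ n := by
    rw [← Real.exp_nat_mul]; congr 1; ring
  rw [mul_pow, he]
  calc Real.exp 1 * Real.exp (-1) ^ n * (4 * Real.pi * Real.sqrt 8 * Real.sqrt (n + 1))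
      ≤ Real.exp 1 * Real.exp (-1) ^ n * (4 * Real.pi * Real.sqrt 8 * 2 ^ n) := by gcongr
    _ = _ := by ring

theorem charFunConst_pos : 0 < charFunConst :=
  summable_charFunConst.tsum_pos (fun n => by positivity) 0 (by positivity)

theorem rpow_le_tsum_indicator {v q : ℝ} (hq : 1 ≤ q) (hv0 : 0 ≤ v) (hv1 : v ≤ 1) :
    ENNReal.ofReal (v ^ q) ≤ ∑' n : ℕ, ENNReal.ofReal (Real.exp 1 * Real.exp (-n)) *
      {w : ℝ | 1 - w ≤ (n + 1) / q}.indicator (fun w => ENNReal.ofReal w) v := by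
  have hq0 : 0 < q := by linarith
  set n := ⌊q * (1 - v)⌋₊ with hn
  refine le_trans ?_ (ENNReal.le_tsum n)
  have hmem : v ∈ {w : ℝ | 1 - w ≤ (n + 1) / q} := by
    simp only [Set.mem_ofPred_eq]
    rw [le_div_iff₀ hq0, mul_comm]
    exact (Nat.lt_floor_add_one _).le
  rw [Set.indicator_of_mem hmem, ← ENNReal.ofReal_mul (by positivity)]
  refine ENNReal.ofReal_le_ofReal ?_
  have hle : (n : ℝ) ≤ q * (1 - v) := Nat.floor_le (by nlinarith)
  rcases hv0.eq_or_lt with rfl | hvpos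
  · rw [Real.zero_rpow (by linarith)]; simp
  calc v ^ q = v ^ (q - 1) * v := by
        rw [← Real.rpow_add_one hvpos.ne']; congr 1; ring
    _ ≤ Real.exp (v - 1) ^ (q - 1) * v := by
        gcongr
        have := Real.add_one_le_exp (v - 1)
        linarith
    _ ≤ Real.exp 1 * Real.exp (-n) * v := by
        gcongr
        rw [← Real.exp_mul, ← Real.exp_add]
        refine Real.exp_le_exp.2 ?_
        nlinarith

/-- For a law with density at most `K`, the characteristic function `φ` satisfies
`∫ |φ| ^ p = O(K / √p)` for `p ≥ 2`; here `p = 2 q`. -/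
theorem lintegral_norm_charFun_rpow_le {μ : Measure ℝ} [IsProbabilityMeasure μ] {K : ℝ≥0}
    (hμ : μ ≤ (K : ℝ≥0∞) • volume) {q : ℝ} (hq : 1 ≤ q) :
    ∫⁻ s : ℝ, ENNReal.ofReal ((‖charFun μ s‖ ^ 2) ^ q) ≤
      ENNReal.ofReal (charFunConst / Real.sqrt q) * K := by
  have hmeas : Measurable (charFun μ) := measurable_charFun
  have hq0 : 0 < q := by linarith
  have hms (u : ℝ) : MeasurableSet {s : ℝ | 1 - ‖charFun μ s‖ ^ 2 ≤ u} :=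
    measurableSet_le (by fun_prop) (by fun_prop)
  calc ∫⁻ s : ℝ, ENNReal.ofReal ((‖charFun μ s‖ ^ 2) ^ q)
      ≤ ∫⁻ s : ℝ, ∑' n : ℕ, ENNReal.ofReal (Real.exp 1 * Real.exp (-n)) *
          {s : ℝ | 1 - ‖charFun μ s‖ ^ 2 ≤ (n + 1) / q}.indicator
            (fun s => ENNReal.ofReal (‖charFun μ s‖ ^ 2)) s := by
        refine lintegral_mono fun s => (rpow_le_tsum_indicator hq (by positivity)
          (norm_charFun_sq_le_one μ s)).trans (le_of_eq ?_)
        simp only [Set.indicator_apply, Set.mem_ofPred_eq]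
    _ = ∑' n : ℕ, ENNReal.ofReal (Real.exp 1 * Real.exp (-n)) *
          ∫⁻ s in {s : ℝ | 1 - ‖charFun μ s‖ ^ 2 ≤ (n + 1) / q},
            ENNReal.ofReal (‖charFun μ s‖ ^ 2) := by
        rw [lintegral_tsum fun n => ((Measurable.indicator (by fun_prop)
          (hms _)).const_mul _).aemeasurable]
        refine tsum_congr fun n => ?_
        rw [lintegral_const_mul _ (Measurable.indicator (by fun_prop) (hms _)),
          lintegral_indicator (hms _)]
    _ ≤ ∑' n : ℕ, ENNReal.ofReal (Real.exp 1 * Real.exp (-n)) *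
          (ENNReal.ofReal (4 * Real.pi * Real.sqrt 8 * Real.sqrt ((n + 1) / q)) * K) := by
        gcongr with n
        exact lintegral_indicator_norm_charFun_sq_le hμ (by positivity)
    _ = ∑' n : ℕ, ENNReal.ofReal (Real.exp 1 * Real.exp (-n) *
          (4 * Real.pi * Real.sqrt 8 * Real.sqrt (n + 1))) *
            (ENNReal.ofReal (1 / Real.sqrt q) * K) := by
        refine tsum_congr fun n => ?_
        rw [← mul_assoc, ← mul_assoc, ← ENNReal.ofReal_mul (by positivity),
          ← ENNReal.ofReal_mul (by positivity), Real.sqrt_div (by positivity)]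
        congr 2
        ring
    _ = _ := by
        rw [ENNReal.tsum_mul_right, ← ENNReal.ofReal_tsum_of_nonneg (fun n => by positivity)
          summable_charFunConst, ← mul_assoc, ← ENNReal.ofReal_mul
            (tsum_nonneg fun n => by positivity), mul_one_div]
        rfl

/-! ### The Cauchy–Binet formula over tuples of columns -/

section CauchyBinet

variable {κ ι : Type*} [Fintype κ] [DecidableEq κ] [Fintype ι]

/-- The Cauchy–Binet formula. The sum runs over all maps `p : κ → ι` instead of all subsets of `ι` of
cardinality `card κ`, so every minor is counted `(card κ)!` times. -/
theorem sum_det_submatrix_mul_det_submatrix {R : Type*} [CommRing R] (M : Matrix κ ι R)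
    (N : Matrix ι κ R) :
    ∑ p : κ → ι, (M.submatrix id p).det * (N.submatrix p id).det =
      (Fintype.card κ).factorial * (M * N).det := by
  have h1 : (M * N).det = ∑ p : κ → ι, (M.submatrix id p).det * ∏ i, N (p i) i := by
    simp_rw [Matrix.det_apply', Matrix.mul_apply, Finset.prod_univ_sum, Finset.mul_sum,
      Finset.sum_mul, Fintype.piFinset_univ]
    rw [Finset.sum_comm]
    refine Finset.sum_congr rfl fun p _ => Finset.sum_congr rfl fun σ _ => ?_
    rw [Finset.prod_mul_distrib, mul_assoc]
    rfl
  have h2 (τ : Equiv.Perm κ) : ∑ p : κ → ι, (M.submatrix id p).det *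
      (Equiv.Perm.sign τ * ∏ i, N (p (τ i)) i) = (M * N).det := by
    rw [h1]
    refine Fintype.sum_equiv (Equiv.arrowCongr τ.symm (Equiv.refl ι)) _ _ fun p => ?_
    have : M.submatrix id (p ∘ τ) = (M.submatrix id p).submatrix id τ := rfl
    change _ = (M.submatrix id (p ∘ τ)).det * ∏ i, N (p (τ i)) i
    rw [this, Matrix.det_permute']
    ring
  calc ∑ p : κ → ι, (M.submatrix id p).det * (N.submatrix p id).det
      = ∑ p : κ → ι, ∑ τ : Equiv.Perm κ, (M.submatrix id p).det *
          (Equiv.Perm.sign τ * ∏ i, N (p (τ i)) i) := by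
        refine Finset.sum_congr rfl fun p _ => ?_
        rw [Matrix.det_apply' (N.submatrix p id), Finset.mul_sum]
        rfl
    _ = _ := by
        rw [Finset.sum_comm, Finset.sum_congr rfl fun τ _ => h2 τ]
        simp [Fintype.card_perm]

variable [DecidableEq ι]

theorem sum_prod_mul_det_submatrix_sq (V : Matrix κ ι ℝ) (x : ι → ℝ) :
    ∑ p : κ → ι, (∏ a, x (p a)) * (V.submatrix id p).det ^ 2 =
      (Fintype.card κ).factorial * (V * Matrix.diagonal x * V.transpose).det := by
  rw [← sum_det_submatrix_mul_det_submatrix]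
  refine Finset.sum_congr rfl fun p _ => ?_
  have h1 : (V * Matrix.diagonal x).submatrix id p =
      Matrix.of fun i j => x (p j) * (V.submatrix id p) i j := by
    ext i j
    simp [Matrix.mul_diagonal, mul_comm]
  have h2 : V.transpose.submatrix p id = (V.submatrix id p).transpose := rfl
  rw [h1, h2, Matrix.det_mul_row, Matrix.det_transpose]
  ring

/-- For a matrix with orthonormal rows, `det (V_p) ^ 2 / (card κ)!` is a probability distribution on
the tuples `p` of columns; it is the determinantal process of the row space. -/
theorem sum_det_submatrix_sq {V : Matrix κ ι ℝ} (hV : V * V.transpose = 1) :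
    ∑ p : κ → ι, (V.submatrix id p).det ^ 2 = (Fintype.card κ).factorial := by
  have h := sum_prod_mul_det_submatrix_sq V 1
  simpa [hV] using h

/-- The expected multiplicity of a column `i` under the distribution of `sum_det_submatrix_sq` is the
square of its length. It is read off from `det (1 + v vᵀ) = 1 + |v|²` by doubling the weight of
the `i`-th column in the Cauchy–Binet formula. -/
theorem sum_card_mul_det_submatrix_sq {V : Matrix κ ι ℝ} (hV : V * V.transpose = 1) (i : ι) :
    ∑ p : κ → ι, (∑ a, if p a = i then (1 : ℝ) else 0) * (V.submatrix id p).det ^ 2 =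
      (Fintype.card κ).factorial * ∑ a, V a i ^ 2 := by
  have h := sum_prod_mul_det_submatrix_sq V (fun l => 1 + if l = i then (1 : ℝ) else 0)
  have hdet : (V * Matrix.diagonal (fun l => 1 + if l = i then (1 : ℝ) else 0) *
      V.transpose).det = 1 + ∑ a, V a i ^ 2 := by
    have hD : V * Matrix.diagonal (fun l => 1 + if l = i then (1 : ℝ) else 0) * V.transpose =
        1 + Matrix.replicateCol Unit (fun a => V a i) * Matrix.replicateRow Unit (fun a => V a i) := by
      rw [← hV]
      ext a b
      rw [Matrix.mul_apply, Matrix.add_apply, Matrix.mul_apply, Matrix.mul_apply]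
      simp [Matrix.mul_diagonal, mul_add, add_mul, Finset.sum_add_distrib]
    rw [hD, Matrix.det_one_add_replicateCol_mul_replicateRow]
    simp [dotProduct, sq]
  have hp (p : κ → ι) : (∏ a, (1 + if p a = i then (1 : ℝ) else 0)) * (V.submatrix id p).det ^ 2 =
      (1 + ∑ a, if p a = i then (1 : ℝ) else 0) * (V.submatrix id p).det ^ 2 := by
    by_cases hinj : Function.Injective p
    · congr 1
      by_cases hex : ∃ a, p a = i
      · obtain ⟨a, rfl⟩ := hex
        simp only [hinj.eq_iff]
        rw [Finset.prod_eq_single a (fun b _ hb => by simp [hb]) (by simp)]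
        simp
      · push Not at hex
        simp [hex]
    · have : (V.submatrix id p).det = 0 := by
        simp only [Function.Injective, not_forall] at hinj
        obtain ⟨a, b, hab, hne⟩ := hinj
        exact Matrix.det_zero_of_column_eq hne fun c => by simp [hab]
      simp [this]
  rw [hdet, Finset.sum_congr rfl fun p _ => hp p] at h
  simp only [add_mul, one_mul, Finset.sum_add_distrib, sum_det_submatrix_sq hV] at h
  linarith

end CauchyBinet

/-! ### A Brascamp–Lieb type inequality -/

theorem ENNReal.prod_rpow_eq_rpow_sum {α : Type*} (s : Finset α) (x : ℝ≥0∞) {e : α → ℝ}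
    (he : ∀ a ∈ s, 0 ≤ e a) : ∏ a ∈ s, x ^ e a = x ^ ∑ a ∈ s, e a := by
  classical
  induction s using Finset.induction with
  | empty => simp
  | insert a s ha ih =>
    rw [Finset.prod_insert ha, Finset.sum_insert ha, ENNReal.rpow_add_of_nonneg _ _
      (he a (by simp)) (Finset.sum_nonneg fun b hb => he b (by simp [hb])),
      ih fun b hb => he b (by simp [hb])]

theorem MeasureTheory.lintegral_pi_prod {κ : Type*} [Fintype κ] {X : κ → Type*}
    [∀ i, MeasurableSpace (X i)] (μ : ∀ i, Measure (X i)) [∀ i, SigmaFinite (μ i)]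
    {f : ∀ i, X i → ℝ≥0∞} (hf : ∀ i, Measurable (f i)) :
    ∫⁻ x, ∏ i, f i (x i) ∂Measure.pi μ = ∏ i, ∫⁻ y, f i y ∂μ i := by
  classical
  have key (s : Finset κ) : (∫⋯∫⁻_s, (fun x => ∏ i ∈ s, f i (x i)) ∂μ) =
      fun _ => ∏ i ∈ s, ∫⁻ y, f i y ∂μ i := by
    induction s using Finset.induction with
    | empty => simp
    | insert i s hi ih =>
      have hmeas (s : Finset κ) : Measurable fun x : ∀ i, X i => ∏ i ∈ s, f i (x i) :=
        Finset.measurable_prod _ fun j _ => (hf j).comp (measurable_pi_apply j)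
      rw [lmarginal_insert' _ (hmeas _) hi]
      have hin (x : ∀ i, X i) : ∫⁻ y, ∏ j ∈ insert i s, f j (Function.update x i y j) ∂μ i =
          (∫⁻ y, f i y ∂μ i) * ∏ j ∈ s, f j (x j) := by
        rw [← lintegral_mul_const _ (hf i)]
        refine lintegral_congr fun y => ?_
        rw [Finset.prod_insert hi, Function.update_self]
        congr 1
        refine Finset.prod_congr rfl fun j hj => ?_
        rw [Function.update_of_ne (ne_of_mem_of_not_mem hj hi)]
      simp_rw [hin]
      funext x
      have := congrFun ih x
      simp only [lmarginal] at this ⊢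
      rw [Finset.prod_insert hi, ← this]
      exact lintegral_const_mul _ ((hmeas s).comp measurable_updateFinset)
  have h := key Finset.univ
  simp only [lmarginal_univ] at h
  by_cases hne : Nonempty (∀ i, X i)
  · exact congrFun h hne.some
  · have : ∃ i, IsEmpty (X i) := by
      by_contra hc
      push Not at hc
      exact hne ⟨fun i => (hc i).some⟩
    obtain ⟨i, hi⟩ := this
    have : IsEmpty (∀ i, X i) := not_nonempty_iff.1 hne
    rw [Finset.prod_eq_zero (Finset.mem_univ i)]
    · simp
    · simp

theorem lintegral_prod_comp_mulVec {κ : Type*} [Fintype κ] [DecidableEq κ] {M : Matrix κ κ ℝ}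
    (hM : M.det ≠ 0) {f : κ → ℝ → ℝ≥0∞} (hf : ∀ a, Measurable (f a)) :
    ∫⁻ η : κ → ℝ, ∏ a, f a (M.mulVec η a) =
      ENNReal.ofReal |M.det⁻¹| * ∏ a, ∫⁻ s, f a s := by
  have hF : Measurable fun y : κ → ℝ => ∏ a, f a (y a) :=
    Finset.measurable_prod _ fun j _ => (hf j).comp (measurable_pi_apply j)
  have h := lintegral_map (μ := volume) hF
    (LinearMap.continuous_of_finiteDimensional (Matrix.toLin' M)).measurable
  rw [Real.map_matrix_volume_pi_eq_smul_volume_pi hM, lintegral_smul_measure] at h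
  simp only [Matrix.toLin'_apply] at h
  rw [← h, volume_pi, lintegral_pi_prod _ hf, smul_eq_mul]

section BrascampLieb

variable {κ ι : Type*} [Fintype κ] [DecidableEq κ] [Fintype ι]

theorem sum_sum_sq_eq_card {V : Matrix κ ι ℝ} (hV : V * V.transpose = 1) :
    ∑ i, ∑ a, V a i ^ 2 = Fintype.card κ := by
  have h := congrArg Matrix.trace hV
  rw [Matrix.trace_one] at h
  rw [← h, Finset.sum_comm]
  simp [Matrix.trace, Matrix.mul_apply, sq]

variable [DecidableEq ι]

/-- The loss in the interpolation of `lintegral_prod_le_of_orthonormal_rows`. By the inequality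
between the arithmetic and the geometric mean it is at most `√(k ^ k / k!)`, hence
exponential in `k` and independent of the number of columns. -/
theorem prod_rpow_det_le {V : Matrix κ ι ℝ} (hV : V * V.transpose = 1) :
    ∏ p : κ → ι, ((∏ a, ∑ b, V b (p a) ^ 2) / (V.submatrix id p).det ^ 2) ^
      ((V.submatrix id p).det ^ 2 / (Fintype.card κ).factorial) ≤
        Real.exp (Fintype.card κ) := by
  set k := Fintype.card κ
  have hk : (0 : ℝ) < k.factorial := by exact_mod_cast k.factorial_pos
  refine (Real.geom_mean_le_arith_mean_weighted _ _ _ (fun p _ => by positivity) ?_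
    (fun p _ => div_nonneg (Finset.prod_nonneg fun a _ => by positivity) (sq_nonneg _))).trans ?_
  · rw [← Finset.sum_div, sum_det_submatrix_sq hV, div_self hk.ne']
  · calc ∑ p : κ → ι, (V.submatrix id p).det ^ 2 / k.factorial *
          ((∏ a, ∑ b, V b (p a) ^ 2) / (V.submatrix id p).det ^ 2)
        ≤ ∑ p : κ → ι, (∏ a, ∑ b, V b (p a) ^ 2) / k.factorial := by
          refine Finset.sum_le_sum fun p _ => ?_
          have hnn : 0 ≤ ∏ a, ∑ b, V b (p a) ^ 2 := Finset.prod_nonneg fun a _ => by positivity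
          by_cases hd : (V.submatrix id p).det = 0
          · rw [hd]
            simp only [ne_eq, OfNat.ofNat_ne_zero, not_false_eq_true, zero_pow, zero_div, zero_mul]
            positivity
          · field_simp
            exact le_rfl
      _ = (k : ℝ) ^ k / k.factorial := by
          have hprod : (k : ℝ) ^ k = ∏ _a : κ, ∑ i, ∑ b, V b i ^ 2 := by
            rw [sum_sum_sq_eq_card hV, Finset.prod_const, Finset.card_univ]
          rw [← Finset.sum_div, hprod, Finset.prod_univ_sum, Fintype.piFinset_univ]
      _ ≤ Real.exp k := Real.pow_div_factorial_le_exp _ (by positivity) _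

/-- A Brascamp–Lieb inequality for the functionals given by the columns of a matrix with orthonormal
rows, with a constant exponential in the number of rows. Hölder's inequality with the weights
`det (V_p) ^ 2 / (card κ)!` reduces it to the change of variables `V_p`. -/
theorem lintegral_prod_le_of_orthonormal_rows {V : Matrix κ ι ℝ} (hV : V * V.transpose = 1)
    {g : ι → ℝ → ℝ≥0∞} (hg : ∀ i, Measurable (g i)) (hg1 : ∀ i s, g i s ≤ 1) {B : ℝ} (hB : 0 ≤ B)
    (hgB : ∀ i, 0 < ∑ a, V a i ^ 2 →
      ∫⁻ s, g i s ^ (1 / ∑ a, V a i ^ 2) ≤ ENNReal.ofReal (B * Real.sqrt (∑ a, V a i ^ 2))) :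
    ∫⁻ η : κ → ℝ, ∏ i, g i (∑ a, V a i * η a) ≤
      ENNReal.ofReal ((B * Real.sqrt (Real.exp 1)) ^ Fintype.card κ) := by
  set k := Fintype.card κ with hkdef
  have hk : (0 : ℝ) < k.factorial := by exact_mod_cast k.factorial_pos
  set c : ι → ℝ := fun i => ∑ a, V a i ^ 2 with hc
  have hc0 (i : ι) : 0 ≤ c i := by positivity
  set w : (κ → ι) → ℝ := fun p => (V.submatrix id p).det ^ 2 / k.factorial with hw
  have hw0 (p : κ → ι) : 0 ≤ w p := by positivity
  have hwsum : ∑ p, w p = 1 := by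
    rw [hw, ← Finset.sum_div, sum_det_submatrix_sq hV, div_self hk.ne']
  have hmarg (i : ι) : ∑ p : κ → ι, ∑ a, (if p a = i then w p else 0) = c i := by
    have h := sum_card_mul_det_submatrix_sq hV i
    rw [mul_comm, ← div_eq_iff hk.ne', Finset.sum_div] at h
    change _ = ∑ a, V a i ^ 2
    rw [← h]
    refine Finset.sum_congr rfl fun p _ => ?_
    rw [mul_div_assoc, Finset.sum_mul]
    exact Finset.sum_congr rfl fun a _ => by simp [hw]
  -- the product is a weighted geometric mean of products over tuples of columns
  have hpt (y : ι → ℝ) : ∏ i, g i (y i) ≤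
      ∏ p : κ → ι, (∏ a, g (p a) (y (p a)) ^ (1 / c (p a))) ^ w p := by
    have h1 (p : κ → ι) : (∏ a, g (p a) (y (p a)) ^ (1 / c (p a))) ^ w p =
        ∏ i, g i (y i) ^ (1 / c i * ∑ a, if p a = i then w p else 0) := by
      rw [← ENNReal.prod_rpow_of_nonneg (hw0 p)]
      have h2 (a : κ) : (g (p a) (y (p a)) ^ (1 / c (p a))) ^ w p =
          ∏ i, g i (y i) ^ (1 / c i * if p a = i then w p else 0) := by
        rw [Finset.prod_eq_single (p a) (fun i _ hi => by simp [hi.symm]) (by simp),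
          ← ENNReal.rpow_mul]
        simp
      rw [Finset.prod_congr rfl fun a _ => h2 a, Finset.prod_comm]
      refine Finset.prod_congr rfl fun i _ => ?_
      rw [ENNReal.prod_rpow_eq_rpow_sum _ _ fun a _ => ?_, Finset.mul_sum]
      split_ifs <;> have := hc0 i <;> have := hw0 p <;> positivity
    rw [Finset.prod_congr rfl fun p _ => h1 p, Finset.prod_comm]
    refine Finset.prod_le_prod' fun i _ => ?_
    rw [ENNReal.prod_rpow_eq_rpow_sum _ _ fun p _ => ?_, ← Finset.mul_sum, hmarg]
    · rcases (hc0 i).eq_or_lt with h0 | h0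
      · rw [← h0]; simpa using hg1 i _
      · rw [one_div, inv_mul_cancel₀ h0.ne', ENNReal.rpow_one]
    · refine mul_nonneg (by have := hc0 i; positivity) (Finset.sum_nonneg fun a _ => ?_)
      split_ifs
      · exact hw0 p
      · exact le_rfl
  have hfm (i : ι) : Measurable fun s => g i s ^ (1 / c i) := (hg i).pow_const _
  have hfac (p : κ → ι) : (∫⁻ η : κ → ℝ,
      ∏ a, g (p a) (∑ b, V b (p a) * η b) ^ (1 / c (p a))) ^ w p ≤
      ENNReal.ofReal ((B ^ k) ^ w p *
        Real.sqrt (((∏ a, c (p a)) / (V.submatrix id p).det ^ 2) ^ w p)) := by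
    by_cases hd : (V.submatrix id p).det = 0
    · have : w p = 0 := by simp [hw, hd]
      simp [this]
    have hcpos (a : κ) : 0 < c (p a) := by
      refine (hc0 _).lt_of_ne fun h0 => hd ?_
      refine Matrix.det_eq_zero_of_column_eq_zero a fun b => ?_
      have := (Finset.sum_eq_zero_iff_of_nonneg (fun b _ => sq_nonneg (V b (p a)))).1 h0.symm b
        (Finset.mem_univ b)
      simpa using this
    have hmv (η : κ → ℝ) (a : κ) : ∑ b, V b (p a) * η b =
        (V.submatrix id p).transpose.mulVec η a := rfl
    simp_rw [hmv]
    rw [lintegral_prod_comp_mulVec (f := fun a s => g (p a) s ^ (1 / c (p a)))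
      (by rwa [Matrix.det_transpose]) (fun a => hfm _), Matrix.det_transpose]
    calc (ENNReal.ofReal |(V.submatrix id p).det⁻¹| * ∏ a, ∫⁻ s, g (p a) s ^ (1 / c (p a))) ^ w p
        ≤ (ENNReal.ofReal |(V.submatrix id p).det⁻¹| *
            ∏ a, ENNReal.ofReal (B * Real.sqrt (c (p a)))) ^ w p := by
          refine ENNReal.rpow_le_rpow ?_ (hw0 p)
          gcongr with a
          exact hgB _ (hcpos a)
      _ = _ := by
          rw [← ENNReal.ofReal_prod_of_nonneg fun a _ => by positivity,
            ← ENNReal.ofReal_mul (abs_nonneg _), ENNReal.ofReal_rpow_of_nonneg (by positivity) (hw0 p)]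
          congr 1
          have hprod : 0 ≤ ∏ a, c (p a) := Finset.prod_nonneg fun a _ => hc0 _
          rw [Real.sqrt_eq_rpow, ← Real.rpow_mul (by positivity), mul_comm (w p),
            Real.rpow_mul (by positivity), ← Real.mul_rpow (by positivity) (by positivity),
            ← Real.sqrt_eq_rpow, Real.sqrt_div hprod, Real.sqrt_sq_eq_abs, abs_inv]
          congr 1
          rw [Finset.prod_mul_distrib, Finset.prod_const, Finset.card_univ, ← hkdef,
            Real.sqrt_prod _ fun a _ => hc0 _]
          ring
  calc ∫⁻ η : κ → ℝ, ∏ i, g i (∑ a, V a i * η a)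
      ≤ ∫⁻ η : κ → ℝ, ∏ p : κ → ι,
          (∏ a, g (p a) (∑ b, V b (p a) * η b) ^ (1 / c (p a))) ^ w p :=
        lintegral_mono fun η => hpt fun i => ∑ b, V b i * η b
    _ ≤ ∏ p : κ → ι, (∫⁻ η : κ → ℝ,
          ∏ a, g (p a) (∑ b, V b (p a) * η b) ^ (1 / c (p a))) ^ w p :=
        ENNReal.lintegral_prod_norm_pow_le _ (fun p _ => (Finset.measurable_prod _ fun a _ =>
          (hfm _).comp (by fun_prop)).aemeasurable) hwsum fun p _ => hw0 p
    _ ≤ ∏ p : κ → ι, ENNReal.ofReal ((B ^ k) ^ w p *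
          Real.sqrt (((∏ a, c (p a)) / (V.submatrix id p).det ^ 2) ^ w p)) :=
        Finset.prod_le_prod' fun p _ => hfac p
    _ ≤ _ := by
        rw [← ENNReal.ofReal_prod_of_nonneg fun p _ => by positivity]
        refine ENNReal.ofReal_le_ofReal ?_
        rw [Finset.prod_mul_distrib, ← Real.rpow_sum_of_nonneg (by positivity) fun p _ => hw0 p,
          hwsum, Real.rpow_one, mul_pow]
        gcongr
        rw [← Real.sqrt_prod _ fun p _ => Real.rpow_nonneg (div_nonneg
          (Finset.prod_nonneg fun a _ => hc0 _) (sq_nonneg _)) _]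
        have h := Real.sqrt_le_sqrt (prod_rpow_det_le hV)
        refine h.trans (le_of_eq ?_)
        rw [← Real.sqrt_sq (pow_nonneg (Real.sqrt_nonneg (Real.exp 1)) k), ← pow_mul,
          mul_comm k, pow_mul, Real.sq_sqrt (Real.exp_pos 1).le, ← Real.exp_nat_mul, mul_one]

end BrascampLieb

/-! ### Gaussian averages of real projections -/

section RealProjection

variable {ι : Type*} [Fintype ι]

theorem lintegral_enorm_charFun_rpow_le {μ : Measure ℝ} [IsProbabilityMeasure μ] {K : ℝ≥0}
    (hμ : μ ≤ (K : ℝ≥0∞) • volume) {c : ℝ} (hc : 0 < c) (hc2 : c ≤ 1 / 2) :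
    ∫⁻ s, ‖charFun μ s‖ₑ ^ (1 / c) ≤
      ENNReal.ofReal (charFunConst * Real.sqrt 2 * K * Real.sqrt c) := by
  have h := lintegral_norm_charFun_rpow_le hμ (q := 1 / (2 * c))
    (by rw [le_div_iff₀ (by positivity)]; linarith)
  have e (s : ℝ) : ‖charFun μ s‖ₑ ^ (1 / c) =
      ENNReal.ofReal ((‖charFun μ s‖ ^ 2) ^ (1 / (2 * c))) := by
    rw [← ofReal_norm, ENNReal.ofReal_rpow_of_nonneg (norm_nonneg _) (by positivity),
      ← Real.rpow_natCast, ← Real.rpow_mul (norm_nonneg _)]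
    congr 2
    push_cast
    field_simp
  simp_rw [e]
  refine h.trans (le_of_eq ?_)
  rw [← ENNReal.ofReal_coe_nnreal, ← ENNReal.ofReal_mul
    (div_nonneg charFunConst_pos.le (Real.sqrt_nonneg _))]
  congr 1
  rw [one_div, Real.sqrt_inv, div_inv_eq_mul, Real.sqrt_mul (by norm_num)]
  ring

theorem exp_neg_sum_sq_eq_integral {κ : Type*} [Fintype κ] {t : ℝ} (ht : 0 < t) (z : κ → ℝ) :
    (((Real.pi : ℂ) / ((t ^ 2 / 2 : ℝ) : ℂ)) ^ (Fintype.card κ / 2 : ℂ)) *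
      ((Real.exp (-((∑ a, z a ^ 2) / (2 * t ^ 2))) : ℝ) : ℂ) =
      ∫ ξ : κ → ℝ, Complex.exp (-((t ^ 2 / 2 : ℝ) : ℂ) * ∑ a, (ξ a : ℂ) ^ 2 +
        ∑ a, (Complex.I * z a) * ξ a) := by
  have hb : 0 < (((t ^ 2 / 2 : ℝ) : ℂ)).re := by
    rw [Complex.ofReal_re]; positivity
  rw [GaussianFourier.integral_cexp_neg_mul_sum_add hb]
  congr 1
  push_cast
  congr 1
  simp_rw [mul_pow, Complex.I_sq, neg_one_mul, Finset.sum_neg_distrib, neg_div]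
  congr 2
  ring

theorem le_norm_gaussian_const {t : ℝ} (ht : 0 < t) (n : ℕ) :
    1 ≤ ‖((Real.pi : ℂ) / ((t ^ 2 / 2 : ℝ) : ℂ)) ^ (n / 2 : ℂ)‖ * t ^ n := by
  rw [← Complex.ofReal_div, Complex.norm_cpow_eq_rpow_re_of_pos (by positivity)]
  have e : ((n : ℂ) / 2).re = (n : ℝ) / 2 := by simp
  have e2 : t ^ n = (t ^ 2) ^ ((n : ℝ) / 2) := by
    rw [← Real.rpow_natCast, ← Real.rpow_natCast, ← Real.rpow_mul ht.le]
    congr 1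
    push_cast
    ring
  rw [e, e2, ← Real.mul_rpow (by positivity) (by positivity)]
  refine Real.one_le_rpow ?_ (by positivity)
  have : Real.pi / (t ^ 2 / 2) * t ^ 2 = 2 * Real.pi := by field_simp
  rw [this]
  linarith [Real.pi_gt_three]

theorem integral_cexp_sum_pi (μ : ι → Measure ℝ) [∀ i, IsProbabilityMeasure (μ i)] (y : ι → ℝ) :
    ∫ x : ι → ℝ, Complex.exp (Complex.I * ∑ i, (y i : ℂ) * x i) ∂Measure.pi μ =
      ∏ i, charFun (μ i) (y i) := by
  have e (x : ι → ℝ) : Complex.exp (Complex.I * ∑ i, (y i : ℂ) * x i) =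
      ∏ i, Complex.exp (y i * x i * Complex.I) := by
    rw [← Complex.exp_sum, ← Finset.sum_mul, mul_comm]
  simp_rw [e, charFun_apply_real]
  exact integral_fintype_prod_eq_prod fun i (x : ℝ) => Complex.exp (y i * x * Complex.I)

/-- Fourier inversion for the Gaussian weight, in the form of an inequality. -/
theorem lintegral_exp_neg_sum_sq_le {κ : Type*} [Fintype κ] (V : Matrix κ ι ℝ) (μ : ι → Measure ℝ)
    [∀ i, IsProbabilityMeasure (μ i)] (w : κ → ℝ) {t : ℝ} (ht : 0 < t) :
    ∫⁻ x, ENNReal.ofReal (Real.exp (-((∑ a, (V.mulVec x a - w a) ^ 2) / (2 * t ^ 2))))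
        ∂Measure.pi μ ≤
      ENNReal.ofReal (t ^ Fintype.card κ) *
        ∫⁻ η : κ → ℝ, ∏ i, ‖charFun (μ i) (∑ a, V a i * η a)‖ₑ := by
  set D : ℂ := ((Real.pi : ℂ) / ((t ^ 2 / 2 : ℝ) : ℂ)) ^ (Fintype.card κ / 2 : ℂ) with hD
  set f : (ι → ℝ) → ℝ := fun x => Real.exp (-((∑ a, (V.mulVec x a - w a) ^ 2) / (2 * t ^ 2)))
    with hf
  have hmv : Continuous fun x : ι → ℝ => V.mulVec x := by fun_prop
  have hfc : Continuous f := by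
    refine Real.continuous_exp.comp (Continuous.neg (Continuous.div_const ?_ _))
    exact continuous_finsetSum _ fun a _ =>
      (((continuous_apply a).comp hmv).sub continuous_const).pow 2
  have hf0 (x : ι → ℝ) : 0 ≤ f x := (Real.exp_pos _).le
  have hfi : Integrable f (Measure.pi μ) :=
    Integrable.of_bound (C := 1) hfc.aestronglyMeasurable (ae_of_all _ fun x => by
      rw [Real.norm_of_nonneg (hf0 x), Real.exp_le_one_iff, neg_nonpos]
      positivity)
  set G : (ι → ℝ) → (κ → ℝ) → ℂ := fun x ξ =>
    Complex.exp (-((t ^ 2 / 2 : ℝ) : ℂ) * ∑ a, (ξ a : ℂ) ^ 2 +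
        ∑ a, (Complex.I * ((V.mulVec x a - w a : ℝ) : ℂ)) * ξ a) with hG
  have hGnorm (x : ι → ℝ) (ξ : κ → ℝ) : ‖G x ξ‖ = Real.exp (-(t ^ 2 / 2) * ∑ a, ξ a ^ 2) := by
    rw [hG, Complex.norm_exp]
    congr 1
    rw [Complex.add_re, Complex.re_sum]
    have h1 : (-((t ^ 2 / 2 : ℝ) : ℂ) * ∑ a, (ξ a : ℂ) ^ 2) =
        ((-(t ^ 2 / 2) * ∑ a, ξ a ^ 2 : ℝ) : ℂ) := by push_cast; rfl
    rw [h1, Complex.ofReal_re, add_eq_left]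
    refine Finset.sum_eq_zero fun a _ => ?_
    rw [Complex.re_mul_ofReal, Complex.re_mul_ofReal]
    simp
  have hGc : Continuous (Function.uncurry G) := by
    refine Complex.continuous_exp.comp (Continuous.add (by fun_prop) ?_)
    refine continuous_finsetSum _ fun a _ => Continuous.mul (Continuous.mul continuous_const ?_)
      (by fun_prop)
    exact Complex.continuous_ofReal.comp
      (((continuous_apply a).comp (hmv.comp continuous_fst)).sub continuous_const)
  have hgauss : Integrable fun ξ : κ → ℝ => Real.exp (-(t ^ 2 / 2) * ∑ a, ξ a ^ 2) := by
    have : Integrable fun ξ : κ → ℝ => ∏ a, Real.exp (-(t ^ 2 / 2) * ξ a ^ 2) :=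
      Integrable.fintype_prod (f := fun _ (y : ℝ) => Real.exp (-(t ^ 2 / 2) * y ^ 2))
        fun _ => integrable_exp_neg_mul_sq (by positivity)
    simpa only [← Real.exp_sum, ← Finset.mul_sum] using this
  have hGi : Integrable (Function.uncurry G) ((Measure.pi μ).prod volume) := by
    refine (hgauss.comp_snd (Measure.pi μ)).mono' hGc.aestronglyMeasurable
      (ae_of_all _ fun p => ?_)
    exact (hGnorm p.1 p.2).le
  have hinner (ξ : κ → ℝ) : ∫ x, G x ξ ∂Measure.pi μ =
      Complex.exp (-((t ^ 2 / 2 : ℝ) : ℂ) * ∑ a, (ξ a : ℂ) ^ 2 -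
        Complex.I * ∑ a, (w a : ℂ) * ξ a) *
        ∏ i, charFun (μ i) (∑ a, V a i * ξ a) := by
    rw [← integral_cexp_sum_pi, ← integral_const_mul]
    refine integral_congr_ae (ae_of_all _ fun x => ?_)
    simp only [hG]
    rw [← Complex.exp_add]
    congr 1
    have h1 : ∑ a, (Complex.I * ((V.mulVec x a - w a : ℝ) : ℂ)) * ξ a =
        Complex.I * ∑ a, ∑ i, (V a i : ℂ) * x i * ξ a - Complex.I * ∑ a, (w a : ℂ) * ξ a := by
      rw [← mul_sub, ← Finset.sum_sub_distrib, Finset.mul_sum]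
      refine Finset.sum_congr rfl fun a _ => ?_
      rw [← Finset.sum_mul]
      simp only [Matrix.mulVec, dotProduct]
      push_cast
      ring
    rw [h1, Finset.sum_comm]
    have h2 : ∑ i, ∑ a, (V a i : ℂ) * x i * ξ a =
        ∑ i, ((∑ a, V a i * ξ a : ℝ) : ℂ) * x i := by
      refine Finset.sum_congr rfl fun i _ => ?_
      push_cast
      rw [Finset.sum_mul]
      exact Finset.sum_congr rfl fun a _ => by ring
    rw [h2]
    ring
  have hmain : D * ((∫ x, f x ∂Measure.pi μ : ℝ) : ℂ) = ∫ ξ : κ → ℝ,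
      Complex.exp (-((t ^ 2 / 2 : ℝ) : ℂ) * ∑ a, (ξ a : ℂ) ^ 2 -
        Complex.I * ∑ a, (w a : ℂ) * ξ a) *
        ∏ i, charFun (μ i) (∑ a, V a i * ξ a) := by
    simp_rw [← hinner]
    rw [← integral_integral_swap hGi, ← integral_complex_ofReal, ← integral_const_mul]
    refine integral_congr_ae (ae_of_all _ fun x => ?_)
    exact exp_neg_sum_sq_eq_integral ht fun a => V.mulVec x a - w a
  have hnorm : ENNReal.ofReal ‖D‖ * ENNReal.ofReal (∫ x, f x ∂Measure.pi μ) ≤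
      ∫⁻ η : κ → ℝ, ∏ i, ‖charFun (μ i) (∑ a, V a i * η a)‖ₑ := by
    have h0 : 0 ≤ ∫ x, f x ∂Measure.pi μ := integral_nonneg hf0
    calc ENNReal.ofReal ‖D‖ * ENNReal.ofReal (∫ x, f x ∂Measure.pi μ)
        = ‖D * ((∫ x, f x ∂Measure.pi μ : ℝ) : ℂ)‖ₑ := by
          rw [enorm_mul, ofReal_norm, ← ofReal_norm (((_ : ℝ) : ℂ)),
            Complex.norm_real, Real.norm_of_nonneg h0]
      _ ≤ _ := by
          rw [hmain]
          refine (enorm_integral_le_lintegral_enorm _).trans (lintegral_mono fun ξ => ?_)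
          rw [enorm_mul, ← ofReal_norm (∏ i, _), norm_prod,
            ENNReal.ofReal_prod_of_nonneg fun i _ => norm_nonneg _]
          simp only [ofReal_norm]
          refine mul_le_of_le_one_left' ?_
          rw [← ofReal_norm, ← ENNReal.ofReal_one]
          refine ENNReal.ofReal_le_ofReal ?_
          have h1 : (-((t ^ 2 / 2 : ℝ) : ℂ) * ∑ a, (ξ a : ℂ) ^ 2 -
              Complex.I * ∑ a, (w a : ℂ) * ξ a) = ((-(t ^ 2 / 2 * ∑ a, ξ a ^ 2) : ℝ) : ℂ) +
              ((-∑ a, w a * ξ a : ℝ) : ℂ) * Complex.I := by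
            push_cast; ring
          rw [h1, Complex.norm_exp, Complex.add_re, Complex.ofReal_re, Complex.re_ofReal_mul,
            Complex.I_re, mul_zero, add_zero, Real.exp_le_one_iff, neg_nonpos]
          positivity
  rw [← ofReal_integral_eq_lintegral_ofReal hfi (ae_of_all _ hf0)]
  calc ENNReal.ofReal (∫ x, f x ∂Measure.pi μ)
      ≤ ENNReal.ofReal (‖D‖ * t ^ Fintype.card κ) * ENNReal.ofReal (∫ x, f x ∂Measure.pi μ) := by
        refine le_mul_of_one_le_left' ?_
        rw [← ENNReal.ofReal_one]
        exact ENNReal.ofReal_le_ofReal (le_norm_gaussian_const ht _)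
    _ = ENNReal.ofReal (t ^ Fintype.card κ) *
          (ENNReal.ofReal ‖D‖ * ENNReal.ofReal (∫ x, f x ∂Measure.pi μ)) := by
        rw [ENNReal.ofReal_mul (norm_nonneg _)]
        ring
    _ ≤ _ := by gcongr

/-- The constant in the bound for Gaussian averages of projections. The first summand comes from
the columns of length at most `1 / √2`, the second from the longer ones. -/
noncomputable def projConst : ℝ :=
  charFunConst * Real.sqrt 2 * Real.sqrt (Real.exp 1) + 2 * Real.sqrt Real.pi

theorem projConst_pos : 0 < projConst := by
  have := charFunConst_pos
  unfold projConst
  positivity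

theorem lintegral_exp_neg_sum_sq_le_of_short_columns {κ : Type*} [Fintype κ] [DecidableEq κ]
    {V : Matrix κ ι ℝ}
    (hV : V * V.transpose = 1) (hshort : ∀ i, ∑ a, V a i ^ 2 ≤ 1 / 2) {μ : ι → Measure ℝ}
    [∀ i, IsProbabilityMeasure (μ i)] {K : ℝ≥0} (hμ : ∀ i, μ i ≤ (K : ℝ≥0∞) • volume)
    (w : κ → ℝ) {t : ℝ} (ht : 0 < t) :
    ∫⁻ x, ENNReal.ofReal (Real.exp (-((∑ a, (V.mulVec x a - w a) ^ 2) / (2 * t ^ 2))))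
        ∂Measure.pi μ ≤ ENNReal.ofReal ((projConst * K * t) ^ Fintype.card κ) := by
  classical
  have hB : 0 ≤ charFunConst * Real.sqrt 2 * K := by have := charFunConst_pos; positivity
  have h := lintegral_prod_le_of_orthonormal_rows hV (g := fun i s => ‖charFun (μ i) s‖ₑ)
    (fun i => measurable_charFun.enorm) (fun i s => by
      rw [← ofReal_norm, ← ENNReal.ofReal_one]
      exact ENNReal.ofReal_le_ofReal (norm_charFun_le_one s)) hB
    fun i hi => lintegral_enorm_charFun_rpow_le (hμ i) hi (hshort i)
  refine (lintegral_exp_neg_sum_sq_le V μ w ht).trans ((mul_le_mul_right h _).trans ?_)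
  rw [← ENNReal.ofReal_mul (by positivity), ← mul_pow]
  refine ENNReal.ofReal_le_ofReal ?_
  refine pow_le_pow_left₀ (by positivity) ?_ _
  calc t * (charFunConst * Real.sqrt 2 * K * Real.sqrt (Real.exp 1))
      = charFunConst * Real.sqrt 2 * Real.sqrt (Real.exp 1) * K * t := by ring
    _ ≤ projConst * K * t := by
        unfold projConst
        gcongr
        exact le_add_of_nonneg_right (by positivity)

end RealProjection

section RealSubspace

variable {ι : Type*} [Fintype ι]

theorem lintegral_exp_neg_norm_starProjection_le_of_short {μ : ι → Measure ℝ}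
    [∀ i, IsProbabilityMeasure (μ i)] {K : ℝ≥0} (hμ : ∀ i, μ i ≤ (K : ℝ≥0∞) • volume)
    [DecidableEq ι] (F : Submodule ℝ (EuclideanSpace ℝ ι))
    (hshort : ∀ i, ‖F.starProjection (EuclideanSpace.single i (1 : ℝ))‖ ^ 2 ≤ 1 / 2)
    (w : EuclideanSpace ℝ ι) {t : ℝ} (ht : 0 < t) :
    ∫⁻ x, ENNReal.ofReal (Real.exp (-(‖F.starProjection (WithLp.toLp 2 x - w)‖ ^ 2 / (2 * t ^ 2))))
      ∂Measure.pi μ ≤ ENNReal.ofReal ((projConst * K * t) ^ Module.finrank ℝ F) := by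
  set b := stdOrthonormalBasis ℝ F
  set V : Matrix (Fin (Module.finrank ℝ F)) ι ℝ := Matrix.of fun a i => (b a : EuclideanSpace ℝ ι) i
  have hnorm (y : EuclideanSpace ℝ ι) : ‖F.starProjection y‖ ^ 2 =
      ∑ a, (∑ i, V a i * y i) ^ 2 := by
    rw [Submodule.starProjection_apply, ← Submodule.coe_norm, ← b.sum_sq_norm_inner_right]
    refine Finset.sum_congr rfl fun a _ => ?_
    rw [Real.norm_eq_abs, sq_abs, Submodule.coe_inner, ← Submodule.starProjection_apply,
      ← Submodule.inner_starProjection_left_eq_right,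
      Submodule.starProjection_eq_self_iff.2 (b a).2, PiLp.inner_apply]
    simp [V, mul_comm]
  have hV : V * V.transpose = 1 := by
    ext a c
    have h := orthonormal_iff_ite.1 b.orthonormal a c
    rw [Submodule.coe_inner, PiLp.inner_apply] at h
    rw [Matrix.mul_apply, Matrix.one_apply, ← h]
    simp [V, mul_comm]
  have hcol (i : ι) : ∑ a, V a i ^ 2 ≤ 1 / 2 := by
    refine le_trans (le_of_eq ?_) (hshort i)
    rw [hnorm]
    simp
  have h := lintegral_exp_neg_sum_sq_le_of_short_columns hV hcol hμ (fun a => ∑ i, V a i * w i) ht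
  rw [Fintype.card_fin] at h
  refine le_trans (le_of_eq (lintegral_congr fun x => ?_)) h
  rw [hnorm]
  simp only [Matrix.mulVec, dotProduct, PiLp.sub_apply, mul_sub, Finset.sum_sub_distrib]

/-- Splitting off the direction of a nonzero projection `u = P e`: in its complement within `F`, the
projection no longer depends on the `e`-component. -/
theorem norm_starProjection_sq_eq_add {E : Type*} [NormedAddCommGroup E] [InnerProductSpace ℝ E]
    [FiniteDimensional ℝ E] (F : Submodule ℝ E) (e y : E) (he : F.starProjection e ≠ 0) :
    ‖F.starProjection y‖ ^ 2 =
      ‖((ℝ ∙ F.starProjection e)ᗮ ⊓ F).starProjection y‖ ^ 2 +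
        inner ℝ (F.starProjection e) y ^ 2 / ‖F.starProjection e‖ ^ 2 := by
  set u := F.starProjection e with hu
  have huF : u ∈ F := Submodule.starProjection_apply_mem _ _
  have hu0 : ‖u‖ ^ 2 ≠ 0 := by positivity
  have huu : inner ℝ u u = ‖u‖ ^ 2 := real_inner_self_eq_norm_sq u
  set z := F.starProjection y - (inner ℝ u y / ‖u‖ ^ 2) • u with hz
  have huy : inner ℝ u (F.starProjection y) = inner ℝ u y := by
    rw [← Submodule.inner_starProjection_left_eq_right, Submodule.starProjection_eq_self_iff.2 huF]
  have huz : inner ℝ u z = 0 := by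
    rw [hz, inner_sub_right, inner_smul_right, huu, huy]
    field_simp
    ring
  have hzF : z ∈ (ℝ ∙ u)ᗮ ⊓ F := by
    refine ⟨Submodule.mem_orthogonal_singleton_iff_inner_right.2 huz, ?_⟩
    exact F.sub_mem (Submodule.starProjection_apply_mem _ _) (F.smul_mem _ huF)
  have hproj : ((ℝ ∙ u)ᗮ ⊓ F).starProjection y = z := by
    refine Submodule.eq_starProjection_of_mem_of_inner_eq_zero hzF fun v hv => ?_
    have h1 : inner ℝ u v = 0 := Submodule.mem_orthogonal_singleton_iff_inner_right.1 hv.1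
    have h2 := Submodule.starProjection_inner_eq_zero (K := F) y v hv.2
    have : y - z = (y - F.starProjection y) + (inner ℝ u y / ‖u‖ ^ 2) • u := by
      rw [hz]; abel
    rw [this, inner_add_left, h2, real_inner_smul_left, h1]
    simp
  have hy : F.starProjection y = z + (inner ℝ u y / ‖u‖ ^ 2) • u := by rw [hz]; abel
  rw [hproj, hy, norm_add_sq_real, inner_smul_right, real_inner_comm u z, huz, norm_smul, mul_pow,
    Real.norm_eq_abs, sq_abs]
  field_simp
  ring

theorem starProjection_orthogonal_inf_eq_zero {E : Type*} [NormedAddCommGroup E]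
    [InnerProductSpace ℝ E] [FiniteDimensional ℝ E] (F : Submodule ℝ E) (e : E) :
    ((ℝ ∙ F.starProjection e)ᗮ ⊓ F).starProjection e = 0 := by
  refine Submodule.eq_starProjection_of_mem_of_inner_eq_zero (Submodule.zero_mem _)
    fun v hv => ?_
  have h1 : inner ℝ (F.starProjection e) v = 0 :=
    Submodule.mem_orthogonal_singleton_iff_inner_right.1 hv.1
  rwa [Submodule.inner_starProjection_left_eq_right, Submodule.starProjection_eq_self_iff.2 hv.2,
    ← sub_zero e] at h1

/-- The Gaussian average of the projection, to a subspace of dimension `k`, of a vector with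
independent coordinates of density at most `K` is at most `(C K t) ^ k`. Coordinates whose
basis vector has a long projection are integrated out one by one; each lowers the dimension
by one and costs a factor `O(K t)`. -/
theorem lintegral_exp_neg_norm_starProjection_le {μ : ι → Measure ℝ}
    [∀ i, IsProbabilityMeasure (μ i)] {K : ℝ≥0} (hμ : ∀ i, μ i ≤ (K : ℝ≥0∞) • volume)
    (F : Submodule ℝ (EuclideanSpace ℝ ι)) (w : EuclideanSpace ℝ ι) {t : ℝ} (ht : 0 < t) :
    ∫⁻ x, ENNReal.ofReal (Real.exp (-(‖F.starProjection (WithLp.toLp 2 x - w)‖ ^ 2 / (2 * t ^ 2))))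
      ∂Measure.pi μ ≤ ENNReal.ofReal ((projConst * K * t) ^ Module.finrank ℝ F) := by
  classical
  induction hk : Module.finrank ℝ F generalizing F with
  | zero =>
    have := lintegral_exp_neg_norm_starProjection_le_of_short hμ F (fun i => ?_) w ht
    · rwa [hk] at this
    · rw [Submodule.finrank_eq_zero.1 hk]; simp
  | succ k ih =>
    by_cases hshort : ∀ i, ‖F.starProjection (EuclideanSpace.single i (1 : ℝ))‖ ^ 2 ≤ 1 / 2
    · have := lintegral_exp_neg_norm_starProjection_le_of_short hμ F hshort w ht
      rwa [hk] at this
    push Not at hshort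
    obtain ⟨i, hi⟩ := hshort
    set e : EuclideanSpace ℝ ι := EuclideanSpace.single i (1 : ℝ) with he
    set u := F.starProjection e with hu
    have hu0 : u ≠ 0 := by rintro h; rw [h] at hi; norm_num at hi
    have hun : 0 < ‖u‖ ^ 2 := by positivity
    set F' := (ℝ ∙ u)ᗮ ⊓ F with hF'
    have hdim : Module.finrank ℝ F' = k := by
      have h := Submodule.finrank_add_inf_finrank_orthogonal (K₁ := ℝ ∙ u) (K₂ := F)
        ((Submodule.span_singleton_le_iff_mem _ _).2 (Submodule.starProjection_apply_mem _ _))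
      rw [finrank_span_singleton hu0, hk] at h
      change 1 + Module.finrank ℝ F' = _ at h
      omega
    have hue : inner ℝ u e = ‖u‖ ^ 2 := by
      have h := Submodule.inner_starProjection_left_eq_right F u e
      rw [Submodule.starProjection_eq_self_iff.2 (Submodule.starProjection_apply_mem _ _),
        ← hu] at h
      rw [h, real_inner_self_eq_norm_sq]
    have hF'e : F'.starProjection e = 0 := starProjection_orthogonal_inf_eq_zero F e
    set G : Submodule ℝ (EuclideanSpace ℝ ι) → (ι → ℝ) → ℝ≥0∞ := fun F x =>
      ENNReal.ofReal (Real.exp (-(‖F.starProjection (WithLp.toLp 2 x - w)‖ ^ 2 / (2 * t ^ 2))))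
      with hG
    have hGm (F) : Measurable (G F) := by
      have : Continuous fun x : ι → ℝ => F.starProjection (WithLp.toLp 2 x - w) :=
        F.starProjection.continuous.comp
          ((PiLp.continuous_toLp 2 _).sub continuous_const)
      exact (ENNReal.continuous_ofReal.comp (Real.continuous_exp.comp
        ((this.norm.pow 2).div_const _).neg)).measurable
    have hupd (x : ι → ℝ) (s : ℝ) : WithLp.toLp 2 (Function.update x i s) - w =
        (WithLp.toLp 2 x - w) + (s - x i) • e := by
      ext j
      by_cases hj : j = i
      · subst hj; simp [he]
      · simp [he, hj]
    have hG' (x : ι → ℝ) (s : ℝ) : G F' (Function.update x i s) = G F' x := by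
      simp only [hG]
      rw [hupd, map_add, map_smul, hF'e, smul_zero, add_zero]
    set c : ℝ≥0∞ := ENNReal.ofReal (2 * Real.sqrt Real.pi * K * t) with hc
    have hinner (x : ι → ℝ) : ∫⁻ s, G F (Function.update x i s) ∂μ i ≤
        ∫⁻ s, c * G F' (Function.update x i s) ∂μ i := by
      set d := x i - inner ℝ u (WithLp.toLp 2 x - w) / ‖u‖ ^ 2 with hd
      have hsplit (s : ℝ) : G F (Function.update x i s) = G F' x *
          ENNReal.ofReal (Real.exp (-(‖u‖ ^ 2 / (2 * t ^ 2)) * (s - d) ^ 2)) := by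
        rw [← hG' x s]
        simp only [hG]
        have hsq := norm_starProjection_sq_eq_add F e
          (WithLp.toLp 2 (Function.update x i s) - w) hu0
        change _ = ‖F'.starProjection _‖ ^ 2 + inner ℝ u _ ^ 2 / ‖u‖ ^ 2 at hsq
        rw [hsq, ← ENNReal.ofReal_mul (Real.exp_pos _).le,
          ← Real.exp_add]
        congr 2
        rw [hupd, inner_add_right, inner_smul_right, hue, hd]
        field_simp
        ring
      simp_rw [hsplit, hG']
      rw [lintegral_const_mul _ (by fun_prop), lintegral_const, measure_univ, mul_one, mul_comm]
      gcongr
      refine (lintegral_exp_neg_mul_sub_sq_le (hμ i) (by positivity) d).trans ?_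
      rw [← ENNReal.ofReal_coe_nnreal, ← ENNReal.ofReal_mul K.coe_nonneg]
      refine ENNReal.ofReal_le_ofReal ?_
      have hs : Real.sqrt (Real.pi / (‖u‖ ^ 2 / (2 * t ^ 2))) ≤ 2 * Real.sqrt Real.pi * t := by
        have h2 : 2 * Real.sqrt Real.pi * t = Real.sqrt (Real.pi * (2 * t) ^ 2) := by
          rw [Real.sqrt_mul Real.pi_pos.le, Real.sqrt_sq (by positivity)]
          ring
        rw [h2]
        refine Real.sqrt_le_sqrt ?_
        rw [div_le_iff₀ (by positivity)]
        have : Real.pi * (2 * t) ^ 2 * (‖u‖ ^ 2 / (2 * t ^ 2)) = Real.pi * (2 * ‖u‖ ^ 2) := by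
          field_simp
        rw [this]
        nlinarith [Real.pi_pos]
      calc (K : ℝ) * Real.sqrt (Real.pi / (‖u‖ ^ 2 / (2 * t ^ 2)))
          ≤ K * (2 * Real.sqrt Real.pi * t) := by gcongr
        _ = _ := by ring
    calc ∫⁻ x, G F x ∂Measure.pi μ
        = (∫⋯∫⁻_Finset.univ, G F ∂μ) 0 := lintegral_eq_lmarginal_univ 0
      _ ≤ (∫⋯∫⁻_Finset.univ, (fun x => c * G F' x) ∂μ) 0 := by
          rw [lmarginal_erase' _ (hGm F) (Finset.mem_univ i),
            lmarginal_erase' _ ((hGm F').const_mul c) (Finset.mem_univ i)]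
          exact lmarginal_mono hinner 0
      _ = c * ∫⁻ x, G F' x ∂Measure.pi μ := by
          rw [← lintegral_eq_lmarginal_univ, lintegral_const_mul _ (hGm F')]
      _ ≤ c * ENNReal.ofReal ((projConst * K * t) ^ k) := by
          gcongr
          exact ih F' hdim
      _ ≤ _ := by
          rw [hc, ← ENNReal.ofReal_mul (by positivity), pow_succ']
          refine ENNReal.ofReal_le_ofReal ?_
          have h1 : 0 ≤ projConst * K * t := by have := projConst_pos; positivity
          gcongr
          unfold projConst
          have := charFunConst_pos
          exact le_add_of_nonneg_left (by positivity)

end RealSubspace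

/-! ### Reduction of complex projections of real vectors to real projections -/

section Complexification

variable {ι : Type*} [Fintype ι]

/-- The inclusion of `ℝ ^ ι` into `ℂ ^ ι`. -/
noncomputable def complexify (ι : Type*) [Fintype ι] :
    EuclideanSpace ℝ ι →ₗ[ℝ] EuclideanSpace ℂ ι where
  toFun x := WithLp.toLp 2 fun i => (x i : ℂ)
  map_add' x y := by ext i; simp
  map_smul' r x := by ext i; simp

/-- The coordinatewise real part `ℂ ^ ι → ℝ ^ ι`. -/
noncomputable def coordRe (ι : Type*) [Fintype ι] :
    EuclideanSpace ℂ ι →ₗ[ℝ] EuclideanSpace ℝ ι where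
  toFun z := WithLp.toLp 2 fun i => (z i).re
  map_add' x y := by ext i; simp
  map_smul' r x := by ext i; simp

theorem re_inner_complexify (z : EuclideanSpace ℂ ι) (y : EuclideanSpace ℝ ι) :
    (inner ℂ z (complexify ι y)).re = inner ℝ (coordRe ι z) y := by
  simp [PiLp.inner_apply, complexify, coordRe]

theorem inner_complexify_left (a : EuclideanSpace ℝ ι) (z : EuclideanSpace ℂ ι) :
    inner ℂ (complexify ι a) z =
      (inner ℝ a (coordRe ι z) : ℂ) - Complex.I * inner ℝ a (coordRe ι (Complex.I • z)) := by
  simp only [PiLp.inner_apply, complexify, coordRe]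
  push_cast
  rw [Finset.mul_sum, ← Finset.sum_sub_distrib]
  refine Finset.sum_congr rfl fun i _ => ?_
  apply Complex.ext <;> simp

theorem norm_sq_eq_coordRe (z : EuclideanSpace ℂ ι) :
    ‖z‖ ^ 2 = ‖coordRe ι z‖ ^ 2 + ‖coordRe ι (Complex.I • z)‖ ^ 2 := by
  rw [EuclideanSpace.norm_sq_eq, EuclideanSpace.norm_sq_eq, EuclideanSpace.norm_sq_eq,
    ← Finset.sum_add_distrib]
  refine Finset.sum_congr rfl fun i _ => ?_
  rw [← Complex.normSq_eq_norm_sq, Complex.normSq_apply]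
  simp [coordRe, sq]

theorem eq_complexify_coordRe (z : EuclideanSpace ℂ ι) :
    z = complexify ι (coordRe ι z) - Complex.I • complexify ι (coordRe ι (Complex.I • z)) := by
  ext i
  apply Complex.ext <;> simp [complexify, coordRe]

theorem norm_starProjection_sq_eq_re_inner {V : Type*} [NormedAddCommGroup V]
    [InnerProductSpace ℂ V] [FiniteDimensional ℂ V] (E : Submodule ℂ V) (z : V) :
    ‖E.starProjection z‖ ^ 2 = (inner ℂ (E.starProjection z) z).re := by
  have h := Submodule.inner_starProjection_left_eq_right E (E.starProjection z) z
  rw [Submodule.starProjection_eq_self_iff.2 (Submodule.starProjection_apply_mem _ _)] at h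
  rw [h, inner_self_eq_norm_sq_to_K]
  norm_cast

/-- The real part of a complex orthogonal projection, as an operator on `ℝ ^ ι`. -/
noncomputable def realProjection (E : Submodule ℂ (EuclideanSpace ℂ ι)) :
    EuclideanSpace ℝ ι →ₗ[ℝ] EuclideanSpace ℝ ι :=
  coordRe ι ∘ₗ (E.starProjection.toLinearMap.restrictScalars ℝ) ∘ₗ complexify ι

theorem inner_realProjection (E : Submodule ℂ (EuclideanSpace ℂ ι)) (x y : EuclideanSpace ℝ ι) :
    inner ℝ (realProjection E x) y =
      (inner ℂ (E.starProjection (complexify ι x)) (complexify ι y)).re :=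
  (re_inner_complexify _ _).symm

theorem inner_realProjection_self (E : Submodule ℂ (EuclideanSpace ℂ ι))
    (x : EuclideanSpace ℝ ι) :
    inner ℝ (realProjection E x) x = ‖E.starProjection (complexify ι x)‖ ^ 2 := by
  rw [inner_realProjection, norm_starProjection_sq_eq_re_inner]

theorem isSymmetric_realProjection (E : Submodule ℂ (EuclideanSpace ℂ ι)) :
    (realProjection E).IsSymmetric := by
  intro x y
  rw [real_inner_comm _ x, inner_realProjection, inner_realProjection,
    Submodule.inner_starProjection_left_eq_right, ← inner_conj_symm, Complex.conj_re]

/-- The real part of a projection to a complex subspace of dimension at least `k` has at least `k`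
eigenvalues in `[1/2, ∞)`: a vector of the subspace orthogonal to all these
eigenvectors would be shortened by the projection. -/
theorem finrank_le_card_eigenvalues (E : Submodule ℂ (EuclideanSpace ℂ ι)) {n : ℕ}
    (b : OrthonormalBasis (Fin n) ℝ (EuclideanSpace ℝ ι)) (μ : Fin n → ℝ)
    (hb : ∀ a, realProjection E (b a) = μ a • b a) :
    Module.finrank ℂ E ≤ (Finset.univ.filter fun a => 1 / 2 ≤ μ a).card := by
  have hquad (p : EuclideanSpace ℝ ι) : ‖E.starProjection (complexify ι p)‖ ^ 2 =
      ∑ a, μ a * inner ℝ (b a) p ^ 2 := by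
    rw [← inner_realProjection_self, ← b.sum_inner_mul_inner]
    refine Finset.sum_congr rfl fun a _ => ?_
    rw [isSymmetric_realProjection E, ← isSymmetric_realProjection E, real_inner_comm,
      ← isSymmetric_realProjection E, hb, real_inner_smul_left]
    ring
  have hsq (p : EuclideanSpace ℝ ι) : ‖p‖ ^ 2 = ∑ a, inner ℝ (b a) p ^ 2 := by
    rw [← b.sum_sq_norm_inner_right]
    simp
  let L : EuclideanSpace ℂ ι →ₗ[ℂ] ({a // a ∈ Finset.univ.filter fun a => 1 / 2 ≤ μ a} → ℂ) :=
    LinearMap.pi fun a => (innerSL ℂ (complexify ι (b a.1))).toLinearMap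
  have hinj : Function.Injective (L ∘ₗ E.subtype) := by
    rw [← LinearMap.ker_eq_bot, LinearMap.ker_eq_bot']
    rintro ⟨y, hy⟩ hLy
    have hy0 (a : Fin n) (ha : 1 / 2 ≤ μ a) : inner ℂ (complexify ι (b a)) y = 0 :=
      congrFun hLy ⟨a, by simpa using ha⟩
    set p := coordRe ι y with hp
    set q := coordRe ι (Complex.I • y) with hq
    have hpq (a : Fin n) (ha : 1 / 2 ≤ μ a) : inner ℝ (b a) p = 0 ∧ inner ℝ (b a) q = 0 := by
      have h := hy0 a ha
      rw [inner_complexify_left] at h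
      constructor
      · simpa using congrArg Complex.re h
      · simpa using congrArg Complex.im h
    have hyn : ‖y‖ ^ 2 = ‖p‖ ^ 2 + ‖q‖ ^ 2 := norm_sq_eq_coordRe y
    have hle : ‖y‖ ^ 2 ≤ 2 * (‖E.starProjection (complexify ι p)‖ ^ 2 +
        ‖E.starProjection (complexify ι q)‖ ^ 2) := by
      have h1 : y = E.starProjection (complexify ι p) -
          Complex.I • E.starProjection (complexify ι q) := by
        conv_lhs => rw [← Submodule.starProjection_eq_self_iff.2 hy, eq_complexify_coordRe y]
        rw [map_sub, map_smul]
      have h2 := norm_sub_le (E.starProjection (complexify ι p))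
        (Complex.I • E.starProjection (complexify ι q))
      rw [← h1, norm_smul, Complex.norm_I, one_mul] at h2
      nlinarith [norm_nonneg y, sq_nonneg (‖E.starProjection (complexify ι p)‖ -
        ‖E.starProjection (complexify ι q)‖)]
    rw [hyn, hquad, hquad, hsq, hsq, ← Finset.sum_add_distrib, ← Finset.sum_add_distrib,
      Finset.mul_sum, ← sub_nonneg, ← Finset.sum_sub_distrib] at hle
    have hterm (a : Fin n) : 0 ≤ (1 - 2 * μ a) *
        (inner ℝ (b a) p ^ 2 + inner ℝ (b a) q ^ 2) := by
      by_cases ha : 1 / 2 ≤ μ a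
      · simp [hpq a ha]
      · exact mul_nonneg (by linarith) (by positivity)
    have hzero : ∑ a, (1 - 2 * μ a) * (inner ℝ (b a) p ^ 2 + inner ℝ (b a) q ^ 2) = 0 := by
      refine le_antisymm ?_ (Finset.sum_nonneg fun a _ => hterm a)
      rw [← neg_nonneg, ← Finset.sum_neg_distrib]
      refine hle.trans (le_of_eq (Finset.sum_congr rfl fun a _ => ?_))
      ring
    rw [Finset.sum_eq_zero_iff_of_nonneg fun a _ => hterm a] at hzero
    have hall (a : Fin n) : inner ℝ (b a) p ^ 2 + inner ℝ (b a) q ^ 2 = 0 := by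
      by_cases ha : 1 / 2 ≤ μ a
      · simp [hpq a ha]
      · rcases mul_eq_zero.1 (hzero a (Finset.mem_univ a)) with h | h
        · exact absurd (by linarith) ha
        · exact h
    have hy2 : ‖y‖ ^ 2 = 0 := by
      rw [hyn, hsq, hsq, ← Finset.sum_add_distrib]
      exact Finset.sum_eq_zero fun a _ => hall a
    ext1
    simpa using hy2
  have h := LinearMap.finrank_le_finrank_of_injective hinj
  rwa [Module.finrank_fintype_fun_eq_card, Fintype.card_coe] at h

/-- The length of the projection, to a complex subspace of dimension at least `k`, of a real vector
translated by `c` dominates, up to `√2`, the length of the projection, to a real subspace of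
dimension `k`, of the real vector translated by some `-w`. The real subspace, spanned by eigenvectors
of the real part of the projection, does not depend on `c`. -/
theorem exists_real_subspace (E : Submodule ℂ (EuclideanSpace ℂ ι)) {k : ℕ}
    (hk : k ≤ Module.finrank ℂ E) :
    ∃ F : Submodule ℝ (EuclideanSpace ℝ ι), Module.finrank ℝ F = k ∧
      ∀ c : EuclideanSpace ℂ ι, ∃ w : EuclideanSpace ℝ ι, ∀ x : EuclideanSpace ℝ ι,
        ‖F.starProjection (x - w)‖ ^ 2 ≤ 2 * ‖E.starProjection (complexify ι x + c)‖ ^ 2 := by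
  obtain ⟨n, b, μ, hb⟩ : ∃ (n : ℕ) (b : OrthonormalBasis (Fin n) ℝ (EuclideanSpace ℝ ι))
      (μ : Fin n → ℝ), ∀ a, realProjection E (b a) = μ a • b a :=
    ⟨_, _, _, (isSymmetric_realProjection E).apply_eigenvectorBasis rfl⟩
  obtain ⟨A, hA, hAk⟩ :=
    Finset.exists_subset_card_eq (hk.trans (finrank_le_card_eigenvalues E b μ hb))
  have hμ {a} (ha : a ∈ A) : 1 / 2 ≤ μ a := by simpa using hA ha
  refine ⟨Submodule.span ℝ (Set.range fun a : A => b a), ?_, fun c => ?_⟩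
  · have hli : LinearIndependent ℝ fun a : A => b a :=
      (b.orthonormal.comp (fun a : A => (a : Fin n)) Subtype.val_injective).linearIndependent
    rw [finrank_span_eq_card hli, Fintype.card_coe, hAk]
  set F := Submodule.span ℝ (Set.range fun a : A => b a) with hF
  set r := coordRe ι (E.starProjection c) with hr
  refine ⟨∑ a ∈ A, (-(inner ℝ (b a) r / μ a)) • b a, fun x => ?_⟩
  set w := ∑ a ∈ A, (-(inner ℝ (b a) r / μ a)) • b a with hw
  set d : _ → ℝ := fun a => inner ℝ (b a) x + inner ℝ (b a) r / μ a with hd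
  set z := ∑ a ∈ A, d a • b a with hz
  have horth (f : _ → ℝ) {a} (ha : a ∈ A) : inner ℝ (b a) (∑ l ∈ A, f l • b l) = f a := by
    rw [b.orthonormal.inner_right_sum f ha]
  have hproj : F.starProjection (x - w) = z := by
    refine Submodule.eq_starProjection_of_mem_of_inner_eq_zero ?_ fun v hv => ?_
    · exact Submodule.sum_mem _ fun a ha => Submodule.smul_mem _ _
        (Submodule.subset_span ⟨⟨a, ha⟩, rfl⟩)
    · induction hv using Submodule.span_induction with
      | mem v hv =>
        obtain ⟨⟨a, ha⟩, rfl⟩ := hv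
        rw [real_inner_comm, inner_sub_right, inner_sub_right, hw, hz, horth _ ha, horth _ ha]
        simp only [hd]
        ring
      | zero => simp
      | add u v _ _ hu hv => rw [inner_add_right, hu, hv, add_zero]
      | smul s v _ hv => rw [inner_smul_right, hv, mul_zero]
  have hSz : realProjection E z = ∑ a ∈ A, (μ a * d a) • b a := by
    rw [hz, map_sum]
    refine Finset.sum_congr rfl fun a _ => ?_
    rw [map_smul, hb, smul_smul, mul_comm]
  have hinner (y : EuclideanSpace ℝ ι) : inner ℝ (realProjection E z) y =
      ∑ a ∈ A, μ a * d a * inner ℝ (b a) y := by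
    rw [hSz, sum_inner]
    exact Finset.sum_congr rfl fun a _ => real_inner_smul_left _ _ _
  have hzz : ‖E.starProjection (complexify ι z)‖ ^ 2 = ∑ a ∈ A, μ a * d a ^ 2 := by
    rw [← inner_realProjection_self, hinner]
    refine Finset.sum_congr rfl fun a ha => ?_
    rw [hz, horth d ha]
    ring
  -- the cross term equals `∑ μ a * d a ^ 2` as well, by the choice of `w`
  have hcross : (inner ℂ (E.starProjection (complexify ι z))
      (E.starProjection (complexify ι x + c))).re = ∑ a ∈ A, μ a * d a ^ 2 := by
    rw [map_add, inner_add_right, Complex.add_re]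
    have h1 : inner ℂ (E.starProjection (complexify ι z)) (E.starProjection (complexify ι x)) =
        inner ℂ (E.starProjection (complexify ι z)) (complexify ι x) := by
      rw [← Submodule.inner_starProjection_left_eq_right,
        Submodule.starProjection_eq_self_iff.2 (Submodule.starProjection_apply_mem _ _)]
    have h2 : (inner ℂ (E.starProjection (complexify ι z)) (E.starProjection c)).re =
        inner ℝ r z := by
      rw [Submodule.inner_starProjection_left_eq_right,
        Submodule.starProjection_eq_self_iff.2 (Submodule.starProjection_apply_mem _ _),
        ← inner_conj_symm, Complex.conj_re, re_inner_complexify]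
    rw [h1, h2, ← inner_realProjection, hinner, hz, inner_sum, ← Finset.sum_add_distrib]
    refine Finset.sum_congr rfl fun a ha => ?_
    have hμ0 : μ a ≠ 0 := by have := hμ ha; linarith
    rw [inner_smul_right, real_inner_comm (b a) r]
    simp only [hd]
    field_simp
  have hnn : 0 ≤ ‖E.starProjection (complexify ι x + c) - E.starProjection (complexify ι z)‖ ^ 2 :=
    sq_nonneg _
  rw [@norm_sub_sq ℂ, hzz, ← inner_conj_symm, RCLike.conj_re, RCLike.re_eq_complex_re,
    hcross] at hnn
  have hzn : ‖z‖ ^ 2 = ∑ a ∈ A, d a ^ 2 := by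
    rw [← real_inner_self_eq_norm_sq]
    conv_lhs => rw [hz, sum_inner]
    refine Finset.sum_congr rfl fun a ha => ?_
    rw [real_inner_smul_left, horth d ha, sq]
  rw [hproj, hzn]
  have hmono : ∑ a ∈ A, d a ^ 2 ≤ 2 * ∑ a ∈ A, μ a * d a ^ 2 := by
    rw [Finset.mul_sum]
    refine Finset.sum_le_sum fun a ha => ?_
    have := hμ ha
    nlinarith [sq_nonneg (d a)]
  linarith

end Complexification

/-! ### The distance to a fixed subspace -/

theorem norm_starProjection_orthogonal_le_infDist {V : Type*} [NormedAddCommGroup V]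
    [InnerProductSpace ℂ V] [FiniteDimensional ℂ V] (H : Submodule ℂ V) (y : V) :
    ‖Hᗮ.starProjection y‖ ≤ Metric.infDist y (H : Set V) := by
  refine (Metric.le_infDist ⟨0, H.zero_mem⟩).2 fun h hh => ?_
  have h0 : Hᗮ.starProjection h = 0 :=
    Submodule.eq_starProjection_of_mem_of_inner_eq_zero (Submodule.zero_mem _) fun v hv => by
      rw [sub_zero]; exact hv h hh
  calc ‖Hᗮ.starProjection y‖ = ‖Hᗮ.starProjection (y - h)‖ := by rw [map_sub, h0, sub_zero]
    _ ≤ ‖y - h‖ := Submodule.norm_starProjection_apply_le _ _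
    _ = dist y h := (dist_eq_norm _ _).symm

/-- The small ball estimate for the distance of a random vector with independent real parts of
bounded density to a fixed complex subspace of codimension at least `k`. -/
theorem measure_infDist_lt_le {ι : Type*} [Fintype ι] {μ : ι → Measure ℝ}
    [∀ i, IsProbabilityMeasure (μ i)] {K : ℝ≥0} (hμ : ∀ i, μ i ≤ (K : ℝ≥0∞) • volume)
    (H : Submodule ℂ (EuclideanSpace ℂ ι)) {k : ℕ}
    (hH : Module.finrank ℂ H + k ≤ Fintype.card ι) (c : EuclideanSpace ℂ ι) {τ : ℝ} (hτ : 0 < τ) :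
    Measure.pi μ {x | Metric.infDist (complexify ι (WithLp.toLp 2 x) + c)
      (H : Set (EuclideanSpace ℂ ι)) < τ * Real.sqrt k} ≤
      ENNReal.ofReal ((Real.exp 1 * projConst * K * τ) ^ k) := by
  have hk : k ≤ Module.finrank ℂ Hᗮ := by
    have h := Submodule.finrank_add_finrank_orthogonal H
    rw [finrank_euclideanSpace] at h
    omega
  obtain ⟨F, hF, hFc⟩ := exists_real_subspace Hᗮ hk
  obtain ⟨w, hw⟩ := hFc c
  set f : (ι → ℝ) → ℝ≥0∞ := fun x => ENNReal.ofReal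
    (Real.exp (-(‖F.starProjection (WithLp.toLp 2 x - w)‖ ^ 2 / (2 * τ ^ 2)))) with hf
  have hfm : Measurable f := by
    have : Continuous fun x : ι → ℝ => F.starProjection (WithLp.toLp 2 x - w) :=
      F.starProjection.continuous.comp ((PiLp.continuous_toLp 2 _).sub continuous_const)
    exact (ENNReal.continuous_ofReal.comp (Real.continuous_exp.comp
      ((this.norm.pow 2).div_const _).neg)).measurable
  have hsub : {x | Metric.infDist (complexify ι (WithLp.toLp 2 x) + c)
      (H : Set (EuclideanSpace ℂ ι)) < τ * Real.sqrt k} ⊆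
      {x | ENNReal.ofReal (Real.exp (-k)) ≤ f x} := by
    intro x hx
    have h1 := (norm_starProjection_orthogonal_le_infDist H _).trans_lt hx
    have h2 := hw (WithLp.toLp 2 x)
    have h3 : ‖Hᗮ.starProjection (complexify ι (WithLp.toLp 2 x) + c)‖ ^ 2 ≤ τ ^ 2 * k := by
      have := pow_le_pow_left₀ (norm_nonneg _) h1.le 2
      rwa [mul_pow, Real.sq_sqrt (by positivity)] at this
    refine ENNReal.ofReal_le_ofReal (Real.exp_le_exp.2 (neg_le_neg ?_))
    rw [div_le_iff₀ (by positivity)]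
    linarith
  have hmarkov := mul_meas_ge_le_lintegral (μ := Measure.pi μ) hfm (ENNReal.ofReal (Real.exp (-k)))
  have hbound := hmarkov.trans (lintegral_exp_neg_norm_starProjection_le hμ F w hτ)
  rw [hF] at hbound
  calc _ ≤ Measure.pi μ {x | ENNReal.ofReal (Real.exp (-k)) ≤ f x} := measure_mono hsub
    _ = ENNReal.ofReal (Real.exp k) * (ENNReal.ofReal (Real.exp (-k)) *
          Measure.pi μ {x | ENNReal.ofReal (Real.exp (-k)) ≤ f x}) := by
        rw [← mul_assoc, ← ENNReal.ofReal_mul (Real.exp_pos _).le, ← Real.exp_add]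
        simp
    _ ≤ ENNReal.ofReal (Real.exp k) * ENNReal.ofReal ((projConst * K * τ) ^ k) := by gcongr
    _ = _ := by
        rw [← ENNReal.ofReal_mul (Real.exp_pos _).le, ← mul_one (k : ℝ), Real.exp_nat_mul,
          ← mul_pow]
        congr 2
        ring

/-! ### Independence and conditioning -/

/-- If every `X i` is independent of the other `X`'s together with `Y`, then the `X i` and `Y` are
jointly independent, and the joint law is a product. -/
theorem map_prodMk_eq_pi_prod {Ω β ι : Type*} [MeasurableSpace Ω] [MeasurableSpace β] [Fintype ι]
    {P : Measure Ω} [IsProbabilityMeasure P] {X : ι → Ω → ℝ} {Y : Ω → β}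
    (hX : ∀ i, Measurable (X i)) (hY : Measurable Y)
    (hind : ∀ i, IndepFun (X i) (fun ω => ((fun l : {l // l ≠ i} => X l ω), Y ω)) P) :
    P.map (fun ω => ((fun i => X i ω), Y ω)) =
      (Measure.pi fun i => P.map (X i)).prod (P.map Y) := by
  classical
  have hprob (i : ι) : IsProbabilityMeasure (P.map (X i)) :=
    Measure.isProbabilityMeasure_map (hX i).aemeasurable
  have hprobY : IsProbabilityMeasure (P.map Y) := Measure.isProbabilityMeasure_map hY.aemeasurable
  have hXY : Measurable fun ω => ((fun i => X i ω), Y ω) :=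
    (measurable_pi_lambda _ hX).prodMk hY
  have key (s : ι → Set ℝ) (hs : ∀ i, MeasurableSet (s i)) (t : Set β) (ht : MeasurableSet t)
      (S : Finset ι) : P ((⋂ i ∈ S, X i ⁻¹' s i) ∩ Y ⁻¹' t) =
        (∏ i ∈ S, P (X i ⁻¹' s i)) * P (Y ⁻¹' t) := by
    induction S using Finset.induction with
    | empty => simp
    | insert a S ha ih =>
      have hR : MeasurableSet ((Set.pi {l : {l // l ≠ a} | l.1 ∈ S} fun l => s l.1) ×ˢ t) :=
        (MeasurableSet.pi (Set.to_countable _) fun l _ => hs l.1).prod ht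
      have h := (hind a).measure_inter_preimage_eq_mul _ _ (hs a) hR
      have hpre : (fun ω => ((fun l : {l // l ≠ a} => X l ω), Y ω)) ⁻¹'
          ((Set.pi {l : {l // l ≠ a} | l.1 ∈ S} fun l => s l.1) ×ˢ t) =
          (⋂ i ∈ S, X i ⁻¹' s i) ∩ Y ⁻¹' t := by
        ext ω
        simp only [Set.mem_preimage, Set.mem_prod, Set.mem_pi, Set.mem_ofPred_eq, Subtype.forall,
          Set.mem_inter_iff, Set.mem_iInter]
        refine and_congr_left fun _ => ⟨fun h i hi => h i ?_ hi, fun h i _ hi => h i hi⟩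
        rintro rfl
        exact ha hi
      rw [hpre, ih] at h
      rw [Finset.set_biInter_insert, Set.inter_assoc, h, Finset.prod_insert ha, mul_assoc]
  refine (Measure.prod_eq_generateFrom (C := Set.pi Set.univ ''
    Set.pi Set.univ fun _ : ι => {s : Set ℝ | MeasurableSet s}) (D := {t : Set β | MeasurableSet t})
    generateFrom_pi MeasurableSpace.generateFrom_measurableSet isPiSystem_pi
    MeasurableSpace.isPiSystem_measurableSet
    ⟨fun _ => Set.univ, fun _ => ⟨fun _ => Set.univ, by simp, by simp⟩,
      fun _ => measure_lt_top _ _, Set.iUnion_const _⟩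
    ⟨fun _ => Set.univ, fun _ => MeasurableSet.univ, fun _ => measure_lt_top _ _,
      Set.iUnion_const _⟩ ?_).symm
  rintro _ ⟨s, hs, rfl⟩ t ht
  have hs' (i : ι) : MeasurableSet (s i) := hs i (Set.mem_univ i)
  rw [Measure.pi_pi, Measure.map_apply hY ht, Measure.map_apply hXY
    ((MeasurableSet.univ_pi hs').prod ht)]
  have hpre : (fun ω => ((fun i => X i ω), Y ω)) ⁻¹' (Set.univ.pi s ×ˢ t) =
      (⋂ i ∈ Finset.univ, X i ⁻¹' s i) ∩ Y ⁻¹' t := by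
    ext ω
    simp
  rw [hpre, key s hs' t ht]
  congr 1
  exact Finset.prod_congr rfl fun i _ => (Measure.map_apply (hX i) (hs' i)).symm

/-- The complex span of the columns of `y`. -/
noncomputable def columnSpan {ι κ : Type*} (y : ι → κ → ℂ) :
    Submodule ℂ (EuclideanSpace ℂ ι) :=
  Submodule.span ℂ (Set.range fun l : κ => WithLp.toLp 2 fun i => y i l)

/-- The distance to the column span is not continuous in the columns, as the span may drop in
dimension, but its strict sublevel sets are open: they are unions of open sets over the
coefficient vectors. -/
theorem isOpen_infDist_columnSpan_lt {ι κ : Type*} [Fintype ι] [Fintype κ]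
    (c : EuclideanSpace ℂ ι) (r : ℝ) :
    IsOpen {p : (ι → ℝ) × (ι → κ → ℂ) |
      Metric.infDist (complexify ι (WithLp.toLp 2 p.1) + c)
        (columnSpan p.2 : Set (EuclideanSpace ℂ ι)) < r} := by
  have heq : {p : (ι → ℝ) × (ι → κ → ℂ) |
      Metric.infDist (complexify ι (WithLp.toLp 2 p.1) + c)
        (columnSpan p.2 : Set (EuclideanSpace ℂ ι)) < r} =
      ⋃ a : κ → ℂ, {p | dist (complexify ι (WithLp.toLp 2 p.1) + c)
        (∑ l, a l • (WithLp.toLp 2 fun i => p.2 i l)) < r} := by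
    ext p
    simp only [Set.mem_ofPred_eq, Set.mem_iUnion]
    rw [Metric.infDist_lt_iff ⟨0, (columnSpan p.2).zero_mem⟩]
    constructor
    · rintro ⟨v, hv, hd⟩
      obtain ⟨a, rfl⟩ := (Submodule.mem_span_range_iff_exists_fun ℂ).1 hv
      exact ⟨a, hd⟩
    · rintro ⟨a, hd⟩
      exact ⟨_, (Submodule.mem_span_range_iff_exists_fun ℂ).2 ⟨a, rfl⟩, hd⟩
  rw [heq]
  refine isOpen_iUnion fun a => isOpen_lt (Continuous.dist ?_ ?_) continuous_const
  · exact ((LinearMap.continuous_of_finiteDimensional (complexify ι)).comp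
      ((PiLp.continuous_toLp 2 _).comp continuous_fst)).add continuous_const
  · refine continuous_finsetSum _ fun l _ => Continuous.fun_const_smul ?_ _
    exact (PiLp.continuous_toLp 2 _).comp (by fun_prop)

/-- The small ball estimate for the distance to the span of random columns, conditionally on which
it is `measure_infDist_lt_le`. -/
theorem measure_infDist_columnSpan_lt_le {Ω ι κ : Type*} [MeasurableSpace Ω] [Fintype ι] [Fintype κ]
    {P : Measure Ω} [IsProbabilityMeasure P] {X : ι → Ω → ℝ} {Y : Ω → ι → κ → ℂ}
    (hX : ∀ i, Measurable (X i)) (hY : Measurable Y)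
    (hind : ∀ i, IndepFun (X i) (fun ω => ((fun l : {l // l ≠ i} => X l ω), Y ω)) P)
    {K : ℝ≥0} (hK : ∀ i, P.map (X i) ≤ (K : ℝ≥0∞) • volume) {k : ℕ}
    (hk : Fintype.card κ + k ≤ Fintype.card ι) (c : EuclideanSpace ℂ ι) {τ : ℝ} (hτ : 0 < τ) :
    P {ω | Metric.infDist (complexify ι (WithLp.toLp 2 fun i => X i ω) + c)
      (columnSpan (Y ω) : Set (EuclideanSpace ℂ ι)) < τ * Real.sqrt k} ≤
      ENNReal.ofReal ((Real.exp 1 * projConst * K * τ) ^ k) := by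
  have hprob (i : ι) : IsProbabilityMeasure (P.map (X i)) :=
    Measure.isProbabilityMeasure_map (hX i).aemeasurable
  have hprobY : IsProbabilityMeasure (P.map Y) := Measure.isProbabilityMeasure_map hY.aemeasurable
  have hXY : Measurable fun ω => ((fun i => X i ω), Y ω) :=
    (measurable_pi_lambda _ hX).prodMk hY
  have hU := (isOpen_infDist_columnSpan_lt (κ := κ) c (τ * Real.sqrt k)).measurableSet
  calc _ = P.map (fun ω => ((fun i => X i ω), Y ω)) {p : (ι → ℝ) × (ι → κ → ℂ) |
      Metric.infDist (complexify ι (WithLp.toLp 2 p.1) + c)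
        (columnSpan p.2 : Set (EuclideanSpace ℂ ι)) < τ * Real.sqrt k} :=
        (Measure.map_apply hXY hU).symm
    _ = ∫⁻ y, (Measure.pi fun i => P.map (X i)) {x | Metric.infDist
          (complexify ι (WithLp.toLp 2 x) + c)
          (columnSpan y : Set (EuclideanSpace ℂ ι)) < τ * Real.sqrt k} ∂(P.map Y) := by
        rw [map_prodMk_eq_pi_prod hX hY hind, Measure.prod_apply_symm hU]
        rfl
    _ ≤ ∫⁻ _y, ENNReal.ofReal ((Real.exp 1 * projConst * K * τ) ^ k) ∂(P.map Y) := by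
        refine lintegral_mono fun y => measure_infDist_lt_le hK _ ?_ c hτ
        exact (Nat.add_le_add_right (finrank_range_le_card _) k).trans hk
    _ = _ := by simp

/-! ### The reduced columns of the shifted block -/

theorem map_re_le_of_boundedDensities {Ω : Type*} [MeasurableSpace Ω] {P : Measure Ω} {n : ℕ}
    {A : Ω → Matrix (Fin n) (Fin n) ℂ} {K : ℝ} (h : BoundedDensities P A K) (i j : Fin n) :
    P.map (fun ω => (A ω i j).re) ≤ (K.toNNReal : ℝ≥0∞) • volume := by
  obtain ⟨hpdf, hle⟩ := h i j
  rw [map_eq_withDensity_pdf (fun ω => (A ω i j).re) P volume, ← withDensity_const]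
  exact withDensity_mono hle

theorem lemma4p4 :
    ∃ C : ℝ, 0 < C ∧
      ∀ (Ω : Type*) [MeasurableSpace Ω] (P : Measure Ω) [IsProbabilityMeasure P]
        (n m k : ℕ) (hmk : m + k ≤ n) (K : ℝ), 1 ≤ K →
        ∀ A : Ω → Matrix (Fin n) (Fin n) ℂ,
          EntryDependence P A → BoundedDensities P A K →
          ∀ (z : ℂ) (j : Fin m) (τ : ℝ), 0 < τ →
            P.real {ω | reducedDist (shiftedBlock hmk (A ω) z) j < τ * Real.sqrt k}
              ≤ (C * K * τ) ^ k := by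
  have hC : 0 < Real.exp 1 * projConst := mul_pos (Real.exp_pos 1) projConst_pos
  refine ⟨Real.exp 1 * projConst, hC, ?_⟩
  intro Ω _ P _ n m k hmk K hK1 A hA hKA z j τ hτ
  have hm : m ≤ n := (Nat.le_add_right m k).trans hmk
  set ι := {i : Fin (m + k) // i ≠ Fin.castAdd k j}
  set κ := {l : Fin m // l ≠ j}
  set row : ι → Fin n := fun i => Fin.castLE hmk i.1
  set col : Fin m → Fin n := Fin.castLE hm
  have hrow (i : ι) : row i ≠ col j := fun h =>
    i.2 (Fin.ext (by simpa [row, col] using congrArg Fin.val h))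
  have hrow_inj {i i' : ι} (h : row i = row i') : i = i' :=
    Subtype.ext (Fin.castLE_injective hmk h)
  have hcol (l : κ) : col l.1 ≠ col j := fun h => l.2 (Fin.castLE_injective hm h)
  set X : ι → Ω → ℝ := fun i ω => (A ω (row i) (col j)).re with hXdef
  set Y : Ω → ι → κ → ℂ := fun ω i l =>
    A ω (row i) (col l.1) - z * (1 : Matrix (Fin n) (Fin n) ℂ) (row i) (col l.1) with hYdef
  have hX (i : ι) : Measurable (X i) := Complex.measurable_re.comp (hA.measurable_entry _ _)
  have hY : Measurable Y := measurable_pi_lambda _ fun i => measurable_pi_lambda _ fun l =>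
    (hA.measurable_entry _ _).sub_const _
  have hind (i : ι) : IndepFun (X i) (fun ω => ((fun l : {l // l ≠ i} => X l ω), Y ω)) P := by
    let ψ : ({p : Fin n × Fin n // p ≠ (row i, col j) ∧ p ≠ (col j, row i)} → ℂ) →
        ({l // l ≠ i} → ℝ) × (ι → κ → ℂ) := fun f =>
      (fun l => (f ⟨(row l.1, col j), fun h => l.2 (hrow_inj (Prod.ext_iff.1 h).1),
        fun h => hrow l.1 (Prod.ext_iff.1 h).1⟩).re,
      fun i' l => f ⟨(row i', col l.1), fun h => hcol l (Prod.ext_iff.1 h).2,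
        fun h => hrow i' (Prod.ext_iff.1 h).1⟩ -
          z * (1 : Matrix (Fin n) (Fin n) ℂ) (row i') (col l.1))
    have hψ : Measurable ψ := by
      refine (measurable_pi_lambda _ fun l => ?_).prodMk
        (measurable_pi_lambda _ fun i' => measurable_pi_lambda _ fun l => ?_)
      · exact Complex.measurable_re.comp (measurable_pi_apply _)
      · exact (measurable_pi_apply _).sub_const _
    exact (hA.indep (row i) (col j)).comp Complex.measurable_re hψ
  have hcard : Fintype.card κ + k ≤ Fintype.card ι := by
    rw [Fintype.card_subtype_compl, Fintype.card_subtype_compl]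
    simp only [Fintype.card_fin, Fintype.card_subtype_eq]
    have := j.pos
    omega
  choose y hy using hA.im_fixed
  set c : EuclideanSpace ℂ ι := WithLp.toLp 2 fun i => (y (row i) (col j) : ℂ) * Complex.I
  have hbound := measure_infDist_columnSpan_lt_le hX hY hind
    (fun i => map_re_le_of_boundedDensities hKA (row i) (col j)) hcard c hτ
  rw [Real.coe_toNNReal K (by linarith)] at hbound
  have hspan (ω : Ω) : reducedSpan (shiftedBlock hmk (A ω) z) j = columnSpan (Y ω) := by
    unfold reducedSpan columnSpan
    congr 1
    ext v
    constructor
    · rintro ⟨l, hl, rfl⟩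
      exact ⟨⟨l, hl⟩, rfl⟩
    · rintro ⟨l, rfl⟩
      exact ⟨l.1, l.2, rfl⟩
  have hcolumn : ∀ᵐ ω ∂P, reducedColumn (shiftedBlock hmk (A ω) z) j j =
      complexify ι (WithLp.toLp 2 fun i => X i ω) + c := by
    have hall : ∀ᵐ ω ∂P, ∀ i : ι, (A ω (row i) (col j)).im = y (row i) (col j) :=
      ae_all_iff.2 fun i => hy _ _
    filter_upwards [hall] with ω hω
    ext i
    change A ω (row i) (col j) - z * (1 : Matrix (Fin n) (Fin n) ℂ) (row i) (col j) =
      ((A ω (row i) (col j)).re : ℂ) + (y (row i) (col j) : ℂ) * Complex.I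
    rw [Matrix.one_apply_ne (hrow i), mul_zero, sub_zero, ← hω i, Complex.re_add_im]
  refine ENNReal.toReal_le_of_le_ofReal (by positivity) (le_trans (measure_mono_ae ?_) hbound)
  filter_upwards [hcolumn] with ω hω h
  change reducedDist (shiftedBlock hmk (A ω) z) j < _ at h
  unfold reducedDist at h
  rw [hω, hspan] at h
  exact h
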